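/- For $a\in\mathbb R^2$ write $a^\perp=(-a_2,a_1)$, for $p\in\mathbb R^2$ write $\widehat p=p/\sqrt{1+|p|^2}$, and for a density $g=g(x,p)$ on $\mathbb R^2\times\mathbb R^2$ write $\rho_g(x)=4\pi\int_{\mathbb R^2} g(x,p)\,dp$ and $j_g(x)=4\pi\int_{\mathbb R^2}\widehat p\,g(x,p)\,dp$. Let $T,L>0$, and let $C_b^k$ denote the space of $C^k$ functions all of whose derivatives up to order $k$ are bounded. Let $$U\in V:=\{d\in W^{2,1}(0,T;C_b^4(\mathbb R^2;\mathbb R^2)) : d(t,x)=0\text{ for }|x|\ge L\}$$ (identified with its continuous representative in time), and let $\mathring f\in C_c^2(\mathbb R^2\times\mathbb R^2)$ with $\mathring f\ge 0$, $\mathring E\in C_b^3(\mathbb R^2;\mathbb R^2)$ and $\mathring B\in C_b^3(\mathbb R^2)$ satisfy $\operatorname{div}\mathring E=\rho_{\mathring f}$. Consider on $[0,T]$ the controlled two-dimensional relativistic Vlasov–Maxwell system $$\begin{aligned} \partial_t f+\widehat p\cdot\partial_x f+(E-\widehat p^{\perp}B)\cdot\partial_p f&=0,\\ \partial_t E_1-\partial_{x_2}B&=-j_{f,1}-U_1,\\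 \partial_t E_2+\partial_{x_1}B&=-j_{f,2}-U_2,\\ \partial_t B+\partial_{x_1}E_2-\partial_{x_2}E_1&=0,\\ \operatorname{div}_xE&=\rho_f-\int_0^t\operatorname{div}_xU\,d\tau,\\ (f,E,B)|_{t=0}&=(\mathring f,\mathring E,\mathring B) \end{aligned}\tag{CVM}$$ for $f=f(t,x,p)\in\mathbb R$, $E=E(t,x)\in\mathbb R^2$, $B=B(t,x)\in\mathbb R$. **Theorem.** The solution of (CVM) is unique in $C^1\times(C^2)^2$: if $(f,E,B)$ and $(\widetilde f,\widetilde E,\widetilde B)$ both satisfy (CVM) pointwise on $[0,T]$, with $f,\widetilde f\in C^1([0,T]\times\mathbb R^4)$, $E,\widetilde E\in C^2([0,T]\times\mathbb R^2;\mathbb R^2)$ and $B,\widetilde B\in C^2([0,T]\times\mathbb R^2)$, then $f=\widetilde f$ on $[0,T]\times\mathbb R^4$, and $E=\widetilde E$ and $B=\widetilde B$ on $[0,T]\times\mathbb R^2$. -/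

import Mathlib

open MeasureTheory Set
open scoped ContDiff

/-- The real vector space of `k`-times continuously differentiable functions all of whose
derivatives up to order `k` are bounded. -/
def CbSubmodule (k : ℕ) (E F : Type) [NormedAddCommGroup E] [NormedSpace ℝ E]
    [NormedAddCommGroup F] [NormedSpace ℝ F] : Submodule ℝ (E → F) where
  carrier := {g | ContDiff ℝ k g ∧
    ∀ j : ℕ, j ≤ k → ∃ C : ℝ, ∀ x, ‖iteratedFDeriv ℝ j g x‖ ≤ C}
  add_mem' := by
    rintro g h ⟨hg, hgb⟩ ⟨hh, hhb⟩
    refine ⟨hg.add hh, fun j hj => ?_⟩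
    obtain ⟨C, hC⟩ := hgb j hj
    obtain ⟨D, hD⟩ := hhb j hj
    have hj' : ((j : ℕ∞) : WithTop ℕ∞) ≤ (k : ℕ∞) := by exact_mod_cast hj
    refine ⟨C + D, fun x => ?_⟩
    rw [iteratedFDeriv_add (hg.of_le hj') (hh.of_le hj')]
    exact (norm_add_le _ _).trans (add_le_add (hC x) (hD x))
  zero_mem' := by
    refine ⟨contDiff_const, fun j _ => ⟨0, fun x => ?_⟩⟩
    have : iteratedFDeriv ℝ j (0 : E → F) = 0 := iteratedFDeriv_fun_zero
    simp [this]
  smul_mem' := by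
    rintro c g ⟨hg, hgb⟩
    refine ⟨hg.const_smul c, fun j hj => ?_⟩
    obtain ⟨C, hC⟩ := hgb j hj
    have hj' : ((j : ℕ∞) : WithTop ℕ∞) ≤ (k : ℕ∞) := by exact_mod_cast hj
    refine ⟨‖c‖ * C, fun x => ?_⟩
    rw [iteratedFDeriv_const_smul_apply (hg.of_le hj').contDiffAt, norm_smul]
    exact mul_le_mul_of_nonneg_left (hC x) (norm_nonneg _)

/-- The space `C_b^k(E; F)`. It is a type synonym, so that it carries the `C_b^k`-norm below and
not the topology of pointwise convergence. -/
def Cb (k : ℕ) (E F : Type) [NormedAddCommGroup E] [NormedSpace ℝ E]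
    [NormedAddCommGroup F] [NormedSpace ℝ F] : Type := CbSubmodule k E F

namespace Cb

noncomputable section

instance (k : ℕ) (E F : Type) [NormedAddCommGroup E] [NormedSpace ℝ E]
    [NormedAddCommGroup F] [NormedSpace ℝ F] : AddCommGroup (Cb k E F) :=
  inferInstanceAs (AddCommGroup (CbSubmodule k E F))

instance (k : ℕ) (E F : Type) [NormedAddCommGroup E] [NormedSpace ℝ E]
    [NormedAddCommGroup F] [NormedSpace ℝ F] : Module ℝ (Cb k E F) :=
  inferInstanceAs (Module ℝ (CbSubmodule k E F))

instance (k : ℕ) (E F : Type) [NormedAddCommGroup E] [NormedSpace ℝ E]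
    [NormedAddCommGroup F] [NormedSpace ℝ F] : CoeFun (Cb k E F) (fun _ => E → F) :=
  ⟨fun g => g.1⟩

/-- The derivatives of orders `0, …, k` of a function in `C_b^k`, as bounded continuous functions. -/
def jet (k : ℕ) (E F : Type) [NormedAddCommGroup E] [NormedSpace ℝ E]
    [NormedAddCommGroup F] [NormedSpace ℝ F] :
    Cb k E F →ₗ[ℝ] ((j : Fin (k + 1)) →
      BoundedContinuousFunction E (ContinuousMultilinearMap ℝ (fun _ : Fin (j : ℕ) => E) F)) where
  toFun g := fun j =>
    { toFun := iteratedFDeriv ℝ j g.1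
      continuous_toFun := g.2.1.continuous_iteratedFDeriv (by
        have := Nat.lt_succ_iff.mp j.2
        exact_mod_cast this)
      map_bounded' := by
        obtain ⟨C, hC⟩ := g.2.2 j (Nat.lt_succ_iff.mp j.2)
        exact ⟨C + C, fun x y => (dist_le_norm_add_norm _ _).trans (add_le_add (hC x) (hC y))⟩ }
  map_add' g h := by
    funext j
    ext1 x
    have hj : ((j : ℕ) : WithTop ℕ∞) ≤ (k : ℕ) := by
      have := Nat.lt_succ_iff.mp j.2
      exact_mod_cast this
    exact iteratedFDeriv_add_apply (g.2.1.of_le hj).contDiffAt (h.2.1.of_le hj).contDiffAt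
  map_smul' c g := by
    funext j
    ext1 x
    have hj : ((j : ℕ) : WithTop ℕ∞) ≤ (k : ℕ) := by
      have := Nat.lt_succ_iff.mp j.2
      exact_mod_cast this
    exact iteratedFDeriv_const_smul_apply (g.2.1.of_le hj).contDiffAt

theorem jet_apply {k : ℕ} {E F : Type} [NormedAddCommGroup E] [NormedSpace ℝ E]
    [NormedAddCommGroup F] [NormedSpace ℝ F] (g : Cb k E F) (j : Fin (k + 1)) (x : E) :
    jet k E F g j x = iteratedFDeriv ℝ j g.1 x := rfl

theorem jet_injective (k : ℕ) (E F : Type) [NormedAddCommGroup E] [NormedSpace ℝ E]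
    [NormedAddCommGroup F] [NormedSpace ℝ F] : Function.Injective (jet k E F) := by
  intro g h hgh
  apply Subtype.ext
  funext x
  have h0 := congrArg (fun a => a 0 x 0) hgh
  exact h0

/-- The `C_b^k`-norm: the maximum over `j ≤ k` of the sup-norms of the `j`-th derivatives. -/
instance (k : ℕ) (E F : Type) [NormedAddCommGroup E] [NormedSpace ℝ E]
    [NormedAddCommGroup F] [NormedSpace ℝ F] : NormedAddCommGroup (Cb k E F) :=
  NormedAddCommGroup.induced (Cb k E F) _ (jet k E F) (jet_injective k E F)

instance (k : ℕ) (E F : Type) [NormedAddCommGroup E] [NormedSpace ℝ E]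
    [NormedAddCommGroup F] [NormedSpace ℝ F] : NormedSpace ℝ (Cb k E F) :=
  NormedSpace.induced ℝ (Cb k E F) _ (jet k E F)

theorem isometry_jet (k : ℕ) (E F : Type) [NormedAddCommGroup E] [NormedSpace ℝ E]
    [NormedAddCommGroup F] [NormedSpace ℝ F] : Isometry (jet k E F) :=
  AddMonoidHomClass.isometry_of_norm (jet k E F) fun _ => rfl

/-- `C_b^k` is a Banach space, so that Bochner integrals in it are the usual ones. -/
instance (k : ℕ) (E F : Type) [NormedAddCommGroup E] [NormedSpace ℝ E]
    [NormedAddCommGroup F] [NormedSpace ℝ F] [CompleteSpace F] : CompleteSpace (Cb k E F) := by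
  refine Metric.complete_of_cauchySeq_tendsto fun u hu => ?_
  obtain ⟨a, ha⟩ := cauchySeq_tendsto_of_complete
    ((isometry_jet k E F).uniformContinuous.comp_cauchySeq hu)
  have huni : ∀ j : Fin (k + 1), TendstoUniformly
      (fun n x => iteratedFDeriv ℝ j (u n).1 x) (a j) Filter.atTop := fun j =>
    BoundedContinuousFunction.tendsto_iff_tendstoUniformly.mp ((tendsto_pi_nhds.mp ha) j)
  let q : E → FormalMultilinearSeries ℝ E F := fun x j =>
    if h : j < k + 1 then a ⟨j, h⟩ x else 0
  have hq : ∀ (j : ℕ) (h : j < k + 1), (fun x => q x j) = a ⟨j, h⟩ := by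
    intro j h
    funext x
    exact dif_pos h
  have hser : HasFTaylorSeriesUpTo k (fun x => (q x 0).curry0) q := by
    refine ⟨fun x => rfl, ?_, ?_⟩
    · intro m hm x
      have hm' : m < k := by exact_mod_cast hm
      refine hasFDerivAt_of_tendstoUniformly (l := Filter.atTop)
        (f := fun n x => iteratedFDeriv ℝ m (u n).1 x)
        (f' := fun n x => (iteratedFDeriv ℝ (m + 1) (u n).1 x).curryLeft)
        (g' := fun x => (q x (m + 1)).curryLeft) ?_ ?_ ?_ x
      · have h1 := huni ⟨m + 1, by omega⟩
        rw [← hq] at h1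
        exact (continuousMultilinearCurryLeftEquiv ℝ (fun _ : Fin (m + 1) => E)
          F).isometry.uniformContinuous.comp_tendstoUniformly h1
      · intro n y
        have h2 := ((contDiff_iff_ftaylorSeries (n := (k : ℕ∞))).mp (u n).2.1).fderiv m
          (by exact_mod_cast hm') y
        exact h2
      · intro y
        have h1 := (huni ⟨m, by omega⟩).tendsto_at y
        rw [← hq] at h1
        exact h1
    · intro m hm
      have hm' : m < k + 1 := by
        have : m ≤ k := by exact_mod_cast hm
        omega
      rw [hq m hm']
      exact (a ⟨m, hm'⟩).continuous
  have hcd : ContDiff ℝ k (fun x => (q x 0).curry0) := hser.contDiff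
  have heq : ∀ (j : ℕ) (h : j < k + 1) (x : E),
      iteratedFDeriv ℝ j (fun x => (q x 0).curry0) x = a ⟨j, h⟩ x := by
    intro j h x
    have h3 := hser.eq_iteratedFDeriv (m := j)
      (by have : j ≤ k := by omega
          exact_mod_cast this) x
    rw [← h3]
    exact congrFun (hq j h) x
  let g : Cb k E F := ⟨fun x => (q x 0).curry0, hcd, fun j hj =>
    ⟨‖a ⟨j, by omega⟩‖, fun x => by
      rw [heq j (by omega) x]
      exact (a ⟨j, by omega⟩).norm_coe_le_norm x⟩⟩
  refine ⟨g, ?_⟩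
  rw [(isometry_jet k E F).isEmbedding.tendsto_nhds_iff]
  have hga : jet k E F g = a := by
    funext j
    ext1 x
    exact heq j j.2 x
  rw [hga]
  exact ha

end

end Cb

/-- `v` is the weak derivative of `u` on the time interval `(0, T)`, both being Bochner integrable
functions with values in the Banach space `X`. -/
def HasWeakTimeDeriv {X : Type} [NormedAddCommGroup X] [NormedSpace ℝ X] (T : ℝ)
    (u v : ℝ → X) : Prop :=
  IntegrableOn u (Ioo 0 T) ∧ IntegrableOn v (Ioo 0 T) ∧
    ∀ φ : ℝ → ℝ, ContDiff ℝ ∞ φ → HasCompactSupport φ → tsupport φ ⊆ Ioo 0 T →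
      ∫ t in Ioo 0 T, deriv φ t • u t = -∫ t in Ioo 0 T, φ t • v t

/-- `u` is the continuous representative, on `[0, T]`, of an element of `W^{2,1}(0, T; X)`. -/
def IsW21 {X : Type} [NormedAddCommGroup X] [NormedSpace ℝ X] (T : ℝ) (u : ℝ → X) : Prop :=
  ContinuousOn u (Icc 0 T) ∧
    ∃ v w : ℝ → X, HasWeakTimeDeriv T u v ∧ HasWeakTimeDeriv T v w

namespace VlasovMaxwell

noncomputable section

/-- The plane `ℝ²` with the Euclidean norm, for positions and for momenta. -/
abbrev Plane : Type := EuclideanSpace ℝ (Fin 2)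

/-- The control space `V`: the `d ∈ W^{2,1}(0, T; C_b^4(ℝ²; ℝ²))` with `d(t, x) = 0` for
`|x| ≥ L`. -/
def controlSpace (T L : ℝ) : Set (ℝ → Cb 4 Plane Plane) :=
  {d | IsW21 T d ∧ ∀ t ∈ Icc 0 T, ∀ x : Plane, L ≤ ‖x‖ → d t x = 0}

/-- The relativistic velocity `p / √(1 + |p|²)` of a particle with momentum `p`. -/
def velocity (p : Plane) : Plane := (Real.sqrt (1 + ‖p‖ ^ 2))⁻¹ • p

/-- `(a₁, a₂)^⊥ = (-a₂, a₁)`. -/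
def perp (a : Plane) : Plane := !₂[-a 1, a 0]

/-- The partial derivative `∂_{x_i} h (x)`; the indices `0`, `1` stand for the two coordinates. -/
def partialX (i : Fin 2) (h : Plane → ℝ) (x : Plane) : ℝ :=
  fderiv ℝ h x (EuclideanSpace.single i 1)

/-- The divergence of a vector field on the plane. -/
def divergence (F : Plane → Plane) (x : Plane) : ℝ :=
  partialX 0 (fun y => F y 0) x + partialX 1 (fun y => F y 1) x

/-- The time derivative on `[0, T]`, one-sided at the end points. -/
def timeDeriv (T : ℝ) (h : ℝ → ℝ) (t : ℝ) : ℝ := derivWithin h (Icc 0 T) t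

/-- The charge density `4π ∫ g(x, p) dp` of a phase space density `g`. -/
def chargeDensity (g : Plane → Plane → ℝ) (x : Plane) : ℝ :=
  4 * Real.pi * ∫ p, g x p

/-- The current density `4π ∫ p̂ g(x, p) dp` of a phase space density `g`. -/
def currentDensity (g : Plane → Plane → ℝ) (x : Plane) : Plane :=
  (4 * Real.pi) • ∫ p, g x p • velocity p

/-- `(f, E, B)` solves the controlled relativistic Vlasov-Maxwell system pointwise on `[0, T]`, with
external current `U` and initial data `(f₀, E₀, B₀)`. -/
structure IsSolution (T : ℝ) (U : ℝ → Plane → Plane) (f₀ : Plane → Plane → ℝ)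
    (E₀ : Plane → Plane) (B₀ : Plane → ℝ)
    (f : ℝ → Plane → Plane → ℝ) (E : ℝ → Plane → Plane) (B : ℝ → Plane → ℝ) : Prop where
  vlasov : ∀ t ∈ Icc 0 T, ∀ x p : Plane,
    timeDeriv T (fun s => f s x p) t
      + inner ℝ (velocity p) (gradient (fun y => f t y p) x)
      + inner ℝ (E t x - B t x • perp (velocity p)) (gradient (fun q => f t x q) p) = 0
  ampere₁ : ∀ t ∈ Icc 0 T, ∀ x : Plane,
    timeDeriv T (fun s => E s x 0) t - partialX 1 (B t) x
      = -currentDensity (f t) x 0 - U t x 0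
  ampere₂ : ∀ t ∈ Icc 0 T, ∀ x : Plane,
    timeDeriv T (fun s => E s x 1) t + partialX 0 (B t) x
      = -currentDensity (f t) x 1 - U t x 1
  faraday : ∀ t ∈ Icc 0 T, ∀ x : Plane,
    timeDeriv T (fun s => B s x) t + partialX 0 (fun y => E t y 1) x
      - partialX 1 (fun y => E t y 0) x = 0
  gauss : ∀ t ∈ Icc 0 T, ∀ x : Plane,
    divergence (E t) x = chargeDensity (f t) x - ∫ τ in (0 : ℝ)..t, divergence (U τ) x
  initial_density : ∀ x p : Plane, f 0 x p = f₀ x p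
  initial_electric : ∀ x : Plane, E 0 x = E₀ x
  initial_magnetic : ∀ x : Plane, B 0 x = B₀ x

/-- `f ∈ C¹([0, T] × ℝ⁴)` and `E, B ∈ C²([0, T] × ℝ²)`. -/
structure IsRegular (T : ℝ) (f : ℝ → Plane → Plane → ℝ) (E : ℝ → Plane → Plane)
    (B : ℝ → Plane → ℝ) : Prop where
  density : ContDiffOn ℝ 1 (fun z : ℝ × Plane × Plane => f z.1 z.2.1 z.2.2) (Icc 0 T ×ˢ univ)
  electric : ContDiffOn ℝ 2 (fun z : ℝ × Plane => E z.1 z.2) (Icc 0 T ×ˢ univ)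
  magnetic : ContDiffOn ℝ 2 (fun z : ℝ × Plane => B z.1 z.2) (Icc 0 T ×ˢ univ)

end

end VlasovMaxwell

/-! The proof is a local `L²` energy estimate for the difference of two solutions, closed by
Gronwall's lemma. Write `g`, `e`, `b` for the differences of the densities, electric fields and
magnetic fields. The external current cancels, so `(e, b)` solves the Maxwell equations with the
current of `g` alone, while along the phase space flow of the first solution `g` has derivative `-(e
- p̂^⊥ b) · ∂_p f'`.

No decay of the fields in space is available, so everything is localized by a weight `W(t, x)`
supported in a backward light cone (`exists_cone_weight`). Since `W` decreases along causal
directions and signals travel at speed at most one, the terms in which `W` is differentiated have a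
favourable sign, both for Maxwell (`fderiv_maxwell_energy_le`) and for transport
(`fderiv_transport_energy_le`).

Integrals in `p` also need compact support. Over a bounded region of space the force is bounded, so
momenta grow at a bounded rate; `transport_nonpos_of_cone`, applied to `f` and `-f`, turns this into
`IsSolution.exists_momentum_bound` without constructing characteristics. On the resulting compact
set `∂_p f'` is bounded, and `∫ W (|e|² + b²) dx + ∫∫ W g² dx dp` has derivative at most a constant
times itself. The phase space field is divergence free (`integral_fderiv_lorentz_eq_zero`), so the
time derivative of the second integral may be taken along the flow. The energy starts at zero, hence
vanishes, and `W` is positive at any prescribed point. -/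

/-! ### Transport equations on backward cones -/

theorem norm_add_smul_neg_smul_sub_le {Z : Type*} [NormedAddCommGroup Z] [NormedSpace ℝ Z]
    (a b c : Z) {θ s : ℝ} (h : 0 ≤ θ * s) :
    ‖a + θ • (-s) • c - b‖ ≤ ‖a - b‖ + θ * s * ‖c‖ := by
  have : a + θ • (-s) • c - b = (a - b) - (θ * s) • c := by
    rw [neg_smul, smul_neg, smul_smul]; abel
  rw [this]
  refine (norm_sub_le _ _).trans ?_
  rw [norm_smul, Real.norm_of_nonneg h]

/-- Weak maximum principle for a transport equation on a backward cone of dependence. -/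
theorem transport_nonpos_of_cone {X Y : Type*} [NormedAddCommGroup X] [NormedSpace ℝ X]
    [ProperSpace X] [NormedAddCommGroup Y] [NormedSpace ℝ Y] [ProperSpace Y]
    {φ : ℝ × X × Y → ℝ} {v : ℝ × X × Y → X × Y} {t K : ℝ} {x : X} {p : Y} (ht : 0 ≤ t)
    (hφ : ContinuousOn φ (Icc 0 t ×ˢ univ))
    (hd : ∀ s ∈ Ioc 0 t, ∀ w, DifferentiableAt ℝ φ (s, w))
    (heq : ∀ s ∈ Ioc 0 t, ∀ w, fderiv ℝ φ (s, w) (1, v (s, w)) = 0)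
    (hv : ∀ s ∈ Icc 0 t, ∀ w, ‖(v (s, w)).1‖ ≤ 1)
    (hF : ∀ s ∈ Icc 0 t, ∀ y q, ‖y - x‖ ≤ t → ‖(v (s, y, q)).2‖ ≤ K)
    (h0 : ∀ y q, ‖y - x‖ ≤ t → ‖q - p‖ ≤ K * t → φ (0, y, q) ≤ 0) :
    φ (t, x, p) ≤ 0 := by
  have hK : 0 ≤ K := (norm_nonneg _).trans (hF 0 ⟨le_rfl, ht⟩ x p (by simpa using ht))
  -- The cone has apex `(t, x, p)` and slopes equal to the speed bounds `1` and `K`, so a backward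
  -- characteristic issued from a point of `D` cannot leave it.
  set D : Set (ℝ × X × Y) :=
    {z | z.1 ∈ Icc 0 t ∧ ‖z.2.1 - x‖ ≤ t - z.1 ∧ ‖z.2.2 - p‖ ≤ K * (t - z.1)} with hD
  have hDsub : D ⊆ Icc 0 t ×ˢ Metric.closedBall x t ×ˢ Metric.closedBall p (K * t) := by
    rintro ⟨s, y, q⟩ ⟨hs, hy, hq⟩
    simp only at hs hy hq
    refine ⟨hs, ?_, ?_⟩
    · rw [Metric.mem_closedBall, dist_eq_norm]
      linarith [hs.1]
    · rw [Metric.mem_closedBall, dist_eq_norm]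
      exact hq.trans (mul_le_mul_of_nonneg_left (by linarith [hs.1]) hK)
  have hDclosed : IsClosed D := by
    refine (isClosed_Icc.preimage continuous_fst).inter (IsClosed.inter ?_ ?_)
    · exact isClosed_le (f := fun z : ℝ × X × Y => ‖z.2.1 - x‖) (g := fun z => t - z.1)
        (by fun_prop) (by fun_prop)
    · exact isClosed_le (f := fun z : ℝ × X × Y => ‖z.2.2 - p‖) (g := fun z => K * (t - z.1))
        (by fun_prop) (by fun_prop)
  have hDc : IsCompact D :=
    (isCompact_Icc.prod ((isCompact_closedBall x t).prod
      (isCompact_closedBall p (K * t)))).of_isClosed_subset hDclosed hDsub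
  have htip : (t, x, p) ∈ D := by simp [hD, ht]
  -- Subtracting `ε s` makes the function strictly decreasing along the flow, which rules out a
  -- maximum at positive time.
  have key : ∀ ε > 0, φ (t, x, p) - ε * t ≤ 0 := by
    intro ε hε
    have hc : ContinuousOn (fun z : ℝ × X × Y => φ z - ε * z.1) D :=
      (hφ.mono fun z hz => ⟨hz.1, mem_univ _⟩).sub (by fun_prop)
    obtain ⟨⟨s, y, q⟩, hz, hmax⟩ := hDc.exists_isMaxOn ⟨_, htip⟩ hc
    have hle : φ (t, x, p) - ε * t ≤ φ (s, y, q) - ε * s := hmax htip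
    obtain ⟨hs, hy, hq⟩ := hz
    simp only at hs hy hq
    rcases hs.1.eq_or_lt with h | h
    · subst h
      have := h0 y q (by simpa using hy) (by simpa using hq)
      linarith
    exfalso
    set w := v (s, y, q) with hw
    -- The backward tangent segment, of length `s` in time so that it ends at time zero, stays in
    -- `D`. The velocity is frozen at the maximum, so no integral curve is needed.
    have hsub : segment ℝ (s, y, q) ((s, y, q) + (-s) • ((1 : ℝ), w)) ⊆ D := by
      rw [segment_eq_image']
      rintro _ ⟨θ, hθ, rfl⟩
      have hθs : 0 ≤ θ * s := mul_nonneg hθ.1 h.le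
      have hθs' : θ * s ≤ s := mul_le_of_le_one_left h.le hθ.2
      have h1 : ‖w.1‖ ≤ 1 := hv s hs _
      have h2 : ‖w.2‖ ≤ K := hF s hs y q (by linarith)
      simp only [add_sub_cancel_left]
      refine ⟨⟨?_, ?_⟩, ?_, ?_⟩
      · simp; linarith
      · simp; linarith [hs.2]
      · refine (norm_add_smul_neg_smul_sub_le y x w.1 hθs).trans ?_
        simp only [Prod.fst_add, Prod.smul_fst, smul_eq_mul, mul_one]
        have : θ * s * ‖w.1‖ ≤ θ * s := mul_le_of_le_one_right hθs h1
        linarith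
      · refine (norm_add_smul_neg_smul_sub_le q p w.2 hθs).trans ?_
        simp only [Prod.fst_add, Prod.smul_fst, smul_eq_mul, mul_one]
        have : θ * s * ‖w.2‖ ≤ θ * s * K := mul_le_mul_of_nonneg_left h2 hθs
        linarith
    have hder : HasFDerivAt (fun z : ℝ × X × Y => φ z - ε * z.1)
        (fderiv ℝ φ (s, y, q) - ε • ContinuousLinearMap.fst ℝ ℝ (X × Y)) (s, y, q) :=
      (hd s ⟨h, hs.2⟩ _).hasFDerivAt.sub (hasFDerivAt_fst.const_mul ε)
    -- At a maximum the derivative in this direction is nonpositive, but the equation makes it equal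
    -- to `s * ε > 0`.
    have hn := hmax.localize.hasFDerivWithinAt_nonpos hder.hasFDerivWithinAt
      (mem_posTangentConeAt_of_segment_subset hsub)
    rw [map_smul, _root_.sub_apply, heq s ⟨h, hs.2⟩] at hn
    simp at hn
    nlinarith [mul_pos h hε]
  refine le_of_forall_pos_le_add fun δ hδ => ?_
  rcases ht.eq_or_lt with h | h
  · have := key 1 one_pos
    rw [← h] at this ⊢
    linarith
  · have := key (δ / t) (div_pos hδ h)
    rw [div_mul_cancel₀ _ h.ne'] at this
    linarith

/-! ### Calculus of compactly supported integrals -/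

theorem integrable_of_continuous_of_zero_off {X F : Type*} [TopologicalSpace X] [T2Space X]
    [MeasurableSpace X] [OpensMeasurableSpace X] {μ : Measure X} [IsFiniteMeasureOnCompacts μ]
    [NormedAddCommGroup F] {u : X → F} {K : Set X} (hu : Continuous u) (hK : IsCompact K)
    (h0 : ∀ x ∉ K, u x = 0) : Integrable u μ :=
  hu.integrable_of_hasCompactSupport (HasCompactSupport.intro hK h0)

theorem fderiv_eq_zero_off {X : Type*} [NormedAddCommGroup X] [NormedSpace ℝ X]
    {u : X → ℝ} {K : Set X} (hK : IsCompact K)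
    (h0 : ∀ x ∉ K, u x = 0) : ∀ x ∉ K, fderiv ℝ u x = 0 := by
  intro x hx
  have : u =ᶠ[nhds x] fun _ => 0 := by
    filter_upwards [hK.isClosed.isOpen_compl.mem_nhds hx] with y hy using h0 y hy
  rw [this.fderiv_eq]
  simp

/-- Vanishing of a space-time function for positive times off a compact set is inherited by its
derivative. -/
theorem fderiv_eq_zero_of_zero_off {X : Type*} [NormedAddCommGroup X] [NormedSpace ℝ X]
    {T : ℝ} {H : ℝ × X → ℝ} {K : Set X} (hK : IsCompact K)
    (h0 : ∀ s ∈ Ioo 0 T, ∀ x ∉ K, H (s, x) = 0) {t : ℝ} (ht : t ∈ Ioo 0 T) :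
    ∀ x ∉ K, fderiv ℝ H (t, x) = 0 := by
  intro x hx
  have : H =ᶠ[nhds (t, x)] fun _ => 0 := by
    filter_upwards [(isOpen_Ioo.prod hK.isClosed.isOpen_compl).mem_nhds
      (show (t, x) ∈ Ioo 0 T ×ˢ Kᶜ from ⟨ht, hx⟩)] with z hz using h0 z.1 hz.1 z.2 hz.2
  rw [this.fderiv_eq]
  simp

section Parts

variable {X : Type*} [NormedAddCommGroup X] [NormedSpace ℝ X] [MeasurableSpace X]
  [BorelSpace X] {μ : Measure X} [μ.IsAddHaarMeasure]

theorem integral_mul_fderiv_eq_neg [FiniteDimensional ℝ X] {c u : X → ℝ} {K : Set X} (hc : ContDiff ℝ 1 c)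
    (hu : ContDiff ℝ 1 u) (hK : IsCompact K) (h0 : ∀ x ∉ K, u x = 0) (d : X) :
    ∫ x, c x * fderiv ℝ u x d ∂μ = -∫ x, fderiv ℝ c x d * u x ∂μ := by
  have hcu : Continuous fun x => fderiv ℝ u x d :=
    (hu.continuous_fderiv (by simp)).clm_apply continuous_const
  have hcc : Continuous fun x => fderiv ℝ c x d :=
    (hc.continuous_fderiv (by simp)).clm_apply continuous_const
  refine integral_mul_fderiv_eq_neg_fderiv_mul_of_integrable ?_ ?_ ?_
    (fun x _ => hc.differentiable (by simp) x) (fun x _ => hu.differentiable (by simp) x)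
  · exact integrable_of_continuous_of_zero_off (hcc.mul hu.continuous) hK
      fun x hx => by simp [h0 x hx]
  · exact integrable_of_continuous_of_zero_off (hc.continuous.mul hcu) hK
      fun x hx => by simp [fderiv_eq_zero_off hK h0 x hx]
  · exact integrable_of_continuous_of_zero_off (hc.continuous.mul hu.continuous) hK
      fun x hx => by simp [h0 x hx]

theorem integral_fderiv_apply_eq_zero [FiniteDimensional ℝ X] {u : X → ℝ} {K : Set X}
    (hu : ContDiff ℝ 1 u) (hK : IsCompact K) (h0 : ∀ x ∉ K, u x = 0) (d : X) :
    ∫ x, fderiv ℝ u x d ∂μ = 0 := by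
  simpa using integral_mul_fderiv_eq_neg (μ := μ) (c := fun _ => 1) contDiff_const hu hK h0 d

/-- Differentiation under the integral sign for a `C¹` integrand with uniformly compact support. -/
theorem hasDerivAt_integral_of_zero_off {H : ℝ × X → ℝ} {T : ℝ} {K : Set X}
    (hH : ContDiffOn ℝ 1 H (Ioo 0 T ×ˢ univ)) (hK : IsCompact K)
    (h0 : ∀ s ∈ Ioo 0 T, ∀ x ∉ K, H (s, x) = 0) {t : ℝ} (ht : t ∈ Ioo 0 T) :
    HasDerivAt (fun s => ∫ x, H (s, x) ∂μ) (∫ x, fderiv ℝ H (t, x) (1, 0) ∂μ) t := by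
  have hopen : IsOpen (Ioo (0 : ℝ) T ×ˢ (univ : Set X)) := isOpen_Ioo.prod isOpen_univ
  have hcf : ContinuousOn (fun z => fderiv ℝ H z (1, 0)) (Ioo 0 T ×ˢ univ) :=
    (hH.continuousOn_fderiv_of_isOpen hopen (by simp)).clm_apply continuousOn_const
  have hz : ∀ s ∈ Ioo 0 T, ∀ x ∉ K, fderiv ℝ H (s, x) (1, 0) = 0 := fun s hs x hx => by
    rw [fderiv_eq_zero_of_zero_off hK h0 hs x hx, _root_.zero_apply]
  have hslice : ∀ {G : ℝ × X → ℝ}, ContinuousOn G (Ioo 0 T ×ˢ univ) → ∀ s ∈ Ioo 0 T,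
      Continuous fun x => G (s, x) := by
    intro G hG s hs
    exact hG.comp_continuous (by fun_prop) fun x => ⟨hs, mem_univ _⟩
  -- The derivative is only known to be continuous on the open time interval; a compact
  -- neighbourhood `[a, b]` of `t` provides the dominating constant.
  obtain ⟨a, ha, hat⟩ := exists_between ht.1
  obtain ⟨b, htb, hb⟩ := exists_between ht.2
  have hsub : Icc a b ⊆ Ioo 0 T := fun s hs => ⟨ha.trans_le hs.1, hs.2.trans_lt hb⟩
  obtain ⟨C, hC⟩ := (isCompact_Icc.prod hK).exists_bound_of_continuousOn
    (hcf.mono (prod_mono hsub (subset_univ K)))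
  have hbd : Integrable (K.indicator fun _ => C) μ :=
    (integrable_indicator_iff hK.isClosed.measurableSet).2
      (integrableOn_const hK.measure_lt_top.ne)
  refine (hasDerivAt_integral_of_dominated_loc_of_deriv_le
    (F := fun s x => H (s, x)) (F' := fun s x => fderiv ℝ H (s, x) (1, 0))
    (Icc_mem_nhds hat htb) ?_ ?_ ?_ (bound := K.indicator fun _ => C) ?_ hbd ?_).2
  · filter_upwards [isOpen_Ioo.mem_nhds ht] with s hs
    exact (hslice hH.continuousOn s hs).aestronglyMeasurable
  · exact integrable_of_continuous_of_zero_off (hslice hH.continuousOn t ht) hK (h0 t ht)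
  · exact (hslice hcf t ht).aestronglyMeasurable
  · refine Filter.Eventually.of_forall fun x s hs => ?_
    by_cases hx : x ∈ K
    · rw [indicator_of_mem hx]
      exact hC (s, x) ⟨hs, hx⟩
    · rw [hz s (hsub hs) x hx, norm_zero, indicator_of_notMem hx]
  · refine Filter.Eventually.of_forall fun x s hs => ?_
    have hd : DifferentiableAt ℝ H (s, x) :=
      (hH.differentiableOn (by simp)).differentiableAt
        (hopen.mem_nhds ⟨hsub hs, mem_univ x⟩)
    have h1 : HasDerivAt (fun r : ℝ => (r, x)) ((1 : ℝ), (0 : X)) s :=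
      (hasDerivAt_id s).prodMk (hasDerivAt_const s x)
    exact hd.hasFDerivAt.comp_hasDerivAt s h1

end Parts

/-! ### Gronwall's lemma and the cone weight -/

/-- A nonnegative function with `y' ≤ C y` that starts at zero vanishes. -/
theorem eq_zero_of_deriv_le_mul {y y' : ℝ → ℝ} {C b : ℝ} (hy : ContinuousOn y (Icc 0 b))
    (hd : ∀ s ∈ Ioo 0 b, HasDerivAt y (y' s) s) (hle : ∀ s ∈ Ioo 0 b, y' s ≤ C * y s)
    (h0 : y 0 = 0) (hnn : ∀ s ∈ Icc 0 b, 0 ≤ y s) : ∀ s ∈ Icc 0 b, y s = 0 := by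
  have hder : ∀ s ∈ Ioo 0 b, HasDerivAt (fun r => Real.exp (-C * r) * y r)
      (Real.exp (-C * s) * (-C) * y s + Real.exp (-C * s) * y' s) s := by
    intro s hs
    have h1 : HasDerivAt (fun r => Real.exp (-C * r)) (Real.exp (-C * s) * (-C)) s := by
      simpa using ((hasDerivAt_id s).const_mul (-C)).exp
    exact h1.mul (hd s hs)
  have hanti : AntitoneOn (fun r => Real.exp (-C * r) * y r) (Icc 0 b) := by
    refine antitoneOn_of_deriv_nonpos (convex_Icc 0 b) ?_ ?_ ?_
    · exact (Continuous.continuousOn (by fun_prop)).mul hy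
    · rw [interior_Icc]
      exact fun s hs => (hder s hs).differentiableAt.differentiableWithinAt
    · rw [interior_Icc]
      intro s hs
      rw [(hder s hs).deriv]
      nlinarith [hle s hs, Real.exp_pos (-C * s)]
  intro s hs
  have h := hanti ⟨le_rfl, hs.1.trans hs.2⟩ hs hs.1
  simp only [h0, mul_zero] at h
  exact le_antisymm (nonpos_of_mul_nonpos_right h (Real.exp_pos _)) (hnn s hs)

/-- A `C¹` weight that is positive inside, and vanishes outside, a slightly curved backward light
cone, and decreases along all causal directions. -/
theorem exists_cone_weight (X : Type*) [NormedAddCommGroup X] [InnerProductSpace ℝ X] (a : ℝ) :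
    ∃ W : ℝ × X → ℝ, ContDiff ℝ 1 W ∧ (∀ z, 0 ≤ W z) ∧
      (∀ t x, 0 ≤ t → a < ‖x‖ → W (t, x) = 0) ∧
      (∀ t x, 1 + ‖x‖ + t < a → 0 < W (t, x)) ∧
      (∀ z r y, ‖y‖ ≤ r → fderiv ℝ W z (r, y) ≤ 0) := by
  have hpos : ∀ x : X, 0 < 1 + ‖x‖ ^ 2 := fun x => by positivity
  -- The square root replaces `‖x‖` to be smooth at the origin. It lies between `‖x‖` and `1 + ‖x‖`,
  -- whence the `1` in the positivity condition, and its gradient has norm at most one, whence the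
  -- causal monotonicity.
  let θ : ℝ × X → ℝ := fun z => a - z.1 - Real.sqrt (1 + ‖z.2‖ ^ 2)
  have hθ : ContDiff ℝ 1 θ := by
    refine (contDiff_const.sub contDiff_fst).sub (ContDiff.sqrt ?_ fun z => (hpos z.2).ne')
    exact contDiff_const.add (contDiff_snd.norm_sq ℝ)
  have hψ : ContDiff ℝ 1 expNegInvGlue := expNegInvGlue.contDiff (n := 1)
  refine ⟨fun z => expNegInvGlue (θ z), hψ.comp hθ, fun z => expNegInvGlue.nonneg _, ?_, ?_, ?_⟩
  · intro t x ht hx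
    refine expNegInvGlue.zero_of_nonpos ?_
    have : ‖x‖ ≤ Real.sqrt (1 + ‖x‖ ^ 2) := Real.le_sqrt_of_sq_le (by linarith)
    simp only [θ]
    linarith
  · intro t x hx
    refine expNegInvGlue.pos_of_pos ?_
    have : Real.sqrt (1 + ‖x‖ ^ 2) ≤ 1 + ‖x‖ :=
      Real.sqrt_le_iff.2 ⟨by positivity, by nlinarith [norm_nonneg x]⟩
    simp only [θ]
    linarith
  · intro z r y hy
    have hθd : HasFDerivAt θ (fderiv ℝ θ z) z := (hθ.differentiable (by simp) z).hasFDerivAt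
    have hψd : HasDerivAt expNegInvGlue (deriv expNegInvGlue (θ z)) (θ z) :=
      (hψ.differentiable (by simp) _).hasDerivAt
    have hW := hψd.comp_hasFDerivAt z hθd
    have hW' : fderiv ℝ (fun z => expNegInvGlue (θ z)) z
        = deriv expNegInvGlue (θ z) • fderiv ℝ θ z := hW.fderiv
    rw [hW', _root_.smul_apply, smul_eq_mul]
    refine mul_nonpos_of_nonneg_of_nonpos (expNegInvGlue.monotone.deriv_nonneg) ?_
    have hs : HasFDerivAt (fun z : ℝ × X => 1 + ‖z.2‖ ^ 2)
        ((2 • (innerSL ℝ z.2)).comp (ContinuousLinearMap.snd ℝ ℝ X)) z := by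
      have := (hasStrictFDerivAt_norm_sq z.2).hasFDerivAt.comp z
        (hasFDerivAt_snd (𝕜 := ℝ) (E := ℝ) (F := X) (p := z))
      exact this.const_add 1
    have hd : HasFDerivAt θ _ z :=
      ((hasFDerivAt_fst (𝕜 := ℝ) (E := ℝ) (F := X) (p := z)).const_sub a).sub
        (hs.sqrt (hpos z.2).ne')
    rw [hd.fderiv]
    simp only [_root_.sub_apply, _root_.neg_apply,
      ContinuousLinearMap.coe_fst', _root_.smul_apply,
      ContinuousLinearMap.comp_apply, ContinuousLinearMap.coe_snd', innerSL_apply_apply,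
      smul_eq_mul, nsmul_eq_mul]
    have hsq : 0 < Real.sqrt (1 + ‖z.2‖ ^ 2) := Real.sqrt_pos.2 (hpos _)
    have h1 : -inner ℝ z.2 y ≤ Real.sqrt (1 + ‖z.2‖ ^ 2) * r := by
      have h2 : ‖z.2‖ ≤ Real.sqrt (1 + ‖z.2‖ ^ 2) := Real.le_sqrt_of_sq_le (by linarith)
      have h3 := neg_le_of_abs_le (abs_real_inner_le_norm z.2 y)
      have h4 : ‖z.2‖ * ‖y‖ ≤ Real.sqrt (1 + ‖z.2‖ ^ 2) * r :=
        mul_le_mul h2 hy (norm_nonneg _) hsq.le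
      linarith
    have h5 : 1 / (2 * Real.sqrt (1 + ‖z.2‖ ^ 2)) * (((2 : ℕ) : ℝ) * inner ℝ z.2 y)
        = inner ℝ z.2 y / Real.sqrt (1 + ‖z.2‖ ^ 2) := by
      push_cast; field_simp
    have h6 : -r ≤ inner ℝ z.2 y / Real.sqrt (1 + ‖z.2‖ ^ 2) := by
      rw [le_div_iff₀ hsq]; linarith
    linarith

theorem integral_sum_mul_fderiv_eq_neg {X : Type*} [NormedAddCommGroup X] [NormedSpace ℝ X]
    [MeasurableSpace X] [BorelSpace X] {μ : Measure X} [μ.IsAddHaarMeasure]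
    [FiniteDimensional ℝ X] {ι : Type*} [Fintype ι] {c : ι → X → ℝ} {u : X → ℝ} {K : Set X}
    (hc : ∀ i, ContDiff ℝ 1 (c i)) (hu : ContDiff ℝ 1 u) (hK : IsCompact K)
    (h0 : ∀ x ∉ K, u x = 0) (d : ι → X) :
    ∫ x, ∑ i, c i x * fderiv ℝ u x (d i) ∂μ = -∫ x, ∑ i, fderiv ℝ (c i) x (d i) * u x ∂μ := by
  rw [integral_finsetSum, integral_finsetSum, ← Finset.sum_neg_distrib]
  · exact Finset.sum_congr rfl fun i _ => integral_mul_fderiv_eq_neg (hc i) hu hK h0 (d i)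
  · exact fun i _ => integrable_of_continuous_of_zero_off
      ((((hc i).continuous_fderiv (by simp)).clm_apply continuous_const).mul hu.continuous) hK
      fun x hx => by simp [h0 x hx]
  · exact fun i _ => integrable_of_continuous_of_zero_off
      ((hc i).continuous.mul ((hu.continuous_fderiv (by simp)).clm_apply continuous_const)) hK
      fun x hx => by simp [fderiv_eq_zero_off hK h0 x hx]

namespace VlasovMaxwell

/-! ### Partial derivatives as directional derivatives in space-time -/

section Slices

variable {X Z : Type*} [NormedAddCommGroup X] [NormedSpace ℝ X]
  [NormedAddCommGroup Z] [NormedSpace ℝ Z]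

theorem differentiableAt_of_contDiffOn_Icc {n : WithTop ℕ∞} (hn : n ≠ 0) {T : ℝ} {h : ℝ × X → Z}
    (hh : ContDiffOn ℝ n h (Icc 0 T ×ˢ univ)) {t : ℝ} (ht : t ∈ Ioo 0 T) (x : X) :
    DifferentiableAt ℝ h (t, x) :=
  (hh.differentiableOn hn).differentiableAt (Filter.mem_of_superset
    ((isOpen_Ioo.prod isOpen_univ).mem_nhds ⟨ht, mem_univ x⟩)
    (prod_mono Ioo_subset_Icc_self le_rfl))

theorem timeDeriv_eq_fderiv {T : ℝ} {h : ℝ × X → ℝ} {t : ℝ} (ht : t ∈ Ioo 0 T) {x : X}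
    (hd : DifferentiableAt ℝ h (t, x)) :
    timeDeriv T (fun s => h (s, x)) t = fderiv ℝ h (t, x) (1, 0) := by
  have h1 : HasDerivAt (fun r : ℝ => (r, x)) ((1 : ℝ), (0 : X)) t :=
    (hasDerivAt_id t).prodMk (hasDerivAt_const t x)
  have h2 : HasDerivAt (fun s => h (s, x)) (fderiv ℝ h (t, x) (1, 0)) t :=
    hd.hasFDerivAt.comp_hasDerivAt t h1
  rw [timeDeriv, derivWithin_of_mem_nhds (Icc_mem_nhds ht.1 ht.2), h2.deriv]

theorem fderiv_slice {h : ℝ × X → Z} {t : ℝ} {x : X} (hd : DifferentiableAt ℝ h (t, x)) (d : X) :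
    fderiv ℝ (fun y => h (t, y)) x d = fderiv ℝ h (t, x) (0, d) := by
  have h1 : HasFDerivAt (fun y : X => (t, y)) (ContinuousLinearMap.inr ℝ ℝ X) x :=
    hasFDerivAt_prodMk_right t x
  have h2 : HasFDerivAt (fun y => h (t, y)) _ x := hd.hasFDerivAt.comp x h1
  rw [h2.fderiv]
  simp

end Slices

/-! ### Relativistic velocity and Lorentz force -/

/-- The Lorentz force `E - p̂^⊥ B`. -/
noncomputable def lorentz (E : Plane) (B : ℝ) (p : Plane) : Plane := E - B • perp (velocity p)

theorem norm_velocity_le (p : Plane) : ‖velocity p‖ ≤ 1 := by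
  have h : 0 < Real.sqrt (1 + ‖p‖ ^ 2) := Real.sqrt_pos.2 (by positivity)
  rw [velocity, norm_smul, norm_inv, Real.norm_of_nonneg h.le, inv_mul_le_iff₀ h, mul_one]
  exact Real.le_sqrt_of_sq_le (by linarith)

theorem norm_perp (a : Plane) : ‖perp a‖ = ‖a‖ := by
  simp [EuclideanSpace.norm_eq, perp, Fin.sum_univ_two, add_comm]

theorem norm_lorentz_le (E : Plane) (B : ℝ) (p : Plane) : ‖lorentz E B p‖ ≤ ‖E‖ + |B| := by
  refine (norm_sub_le _ _).trans (add_le_add_right ?_ _)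
  rw [norm_smul, norm_perp, Real.norm_eq_abs]
  exact mul_le_of_le_one_right (abs_nonneg _) (norm_velocity_le p)

theorem lorentz_sub (E E' : Plane) (B B' : ℝ) (p : Plane) :
    lorentz E B p - lorentz E' B' p = lorentz (E - E') (B - B') p := by
  simp only [lorentz, sub_smul]
  abel

theorem lorentz_zero (E : Plane) (B : ℝ) (p : Plane) :
    lorentz E B p 0 = E 0 + B * velocity p 1 := by
  simp [lorentz, perp]

theorem lorentz_one (E : Plane) (B : ℝ) (p : Plane) :
    lorentz E B p 1 = E 1 - B * velocity p 0 := by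
  simp [lorentz, perp]

theorem contDiff_velocity {n : WithTop ℕ∞} : ContDiff ℝ n velocity := by
  have hpos : ∀ p : Plane, 0 < 1 + ‖p‖ ^ 2 := fun p => by positivity
  refine ContDiff.smul (ContDiff.inv (ContDiff.sqrt ?_ fun p => (hpos p).ne')
    fun p => (Real.sqrt_pos.2 (hpos p)).ne') contDiff_id
  exact contDiff_const.add (contDiff_id.norm_sq ℝ)

theorem fderiv_velocity_apply (p d : Plane) (i : Fin 2) :
    fderiv ℝ (fun q => velocity q i) p d = (Real.sqrt (1 + ‖p‖ ^ 2))⁻¹ * d i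
      - (Real.sqrt (1 + ‖p‖ ^ 2))⁻¹ ^ 3 * inner ℝ p d * p i := by
  have hpos : 0 < 1 + ‖p‖ ^ 2 := by positivity
  have hsq : 0 < Real.sqrt (1 + ‖p‖ ^ 2) := Real.sqrt_pos.2 hpos
  have hs : HasFDerivAt (fun p : Plane => 1 + ‖p‖ ^ 2) (2 • innerSL ℝ p) p :=
    (hasStrictFDerivAt_norm_sq p).hasFDerivAt.const_add 1
  have hinv := (hasDerivAt_inv hsq.ne').comp_hasFDerivAt p (hs.sqrt hpos.ne')
  have hp : HasFDerivAt (fun q : Plane => q i) (EuclideanSpace.proj i : Plane →L[ℝ] ℝ) p :=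
    (EuclideanSpace.proj i : Plane →L[ℝ] ℝ).hasFDerivAt
  have h : HasFDerivAt (fun q => velocity q i) _ p := hinv.mul hp
  rw [h.fderiv]
  simp
  field_simp
  ring

/-- The velocity is the gradient of `√(1 + |p|²)`, so its Jacobian is symmetric. This makes the
magnetic force divergence free in `p`. -/
theorem curl_velocity (p : Plane) :
    fderiv ℝ (fun q => velocity q 1) p (EuclideanSpace.single 0 1)
      = fderiv ℝ (fun q => velocity q 0) p (EuclideanSpace.single 1 1) := by
  rw [fderiv_velocity_apply, fderiv_velocity_apply]
  simp [EuclideanSpace.inner_single_right]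
  ring

theorem eq_sum_single (a : Plane) :
    a = a 0 • EuclideanSpace.single 0 (1 : ℝ) + a 1 • EuclideanSpace.single 1 (1 : ℝ) := by
  ext i
  fin_cases i <;> simp

/-! ### The equations at interior times, and the momentum support -/

section Solution

variable {T : ℝ} {U : ℝ → Plane → Plane} {f₀ : Plane → Plane → ℝ} {E₀ : Plane → Plane}
  {B₀ : Plane → ℝ} {f : ℝ → Plane → Plane → ℝ} {E : ℝ → Plane → Plane} {B : ℝ → Plane → ℝ}

theorem IsRegular.contDiffOn_electric_apply (hr : IsRegular T f E B) (i : Fin 2) :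
    ContDiffOn ℝ 2 (fun z : ℝ × Plane => E z.1 z.2 i) (Icc 0 T ×ˢ univ) :=
  (EuclideanSpace.proj i : Plane →L[ℝ] ℝ).contDiff.comp_contDiffOn hr.electric

/-- The Vlasov equation as one directional derivative, the form used by the cone principle and the
energy estimate. At interior times the one-sided time derivative is a genuine one. -/
theorem IsSolution.fderiv_density (hr : IsRegular T f E B) (hs : IsSolution T U f₀ E₀ B₀ f E B)
    {t : ℝ} (ht : t ∈ Ioo 0 T) (x p : Plane) :
    fderiv ℝ (fun z : ℝ × Plane × Plane => f z.1 z.2.1 z.2.2) (t, x, p)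
      (1, velocity p, lorentz (E t x) (B t x) p) = 0 := by
  have hd := differentiableAt_of_contDiffOn_Icc one_ne_zero hr.density ht (x, p)
  have h := hs.vlasov t (Ioo_subset_Icc_self ht) x p
  rw [timeDeriv_eq_fderiv (h := fun z : ℝ × Plane × Plane => f z.1 z.2.1 z.2.2) ht hd] at h
  have h1 : HasFDerivAt (fun y : Plane => (t, y, p)) ((0 : Plane →L[ℝ] ℝ).prod
      ((ContinuousLinearMap.id ℝ Plane).prod 0)) x :=
    (hasFDerivAt_const t x).prodMk ((hasFDerivAt_id x).prodMk (hasFDerivAt_const p x))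
  have h2 : HasFDerivAt (fun q : Plane => (t, x, q)) ((0 : Plane →L[ℝ] ℝ).prod
      ((0 : Plane →L[ℝ] Plane).prod (ContinuousLinearMap.id ℝ Plane))) p :=
    (hasFDerivAt_const t p).prodMk ((hasFDerivAt_const x p).prodMk (hasFDerivAt_id p))
  have hx : HasFDerivAt (fun y => f t y p) _ x := HasFDerivAt.comp
    (g := fun z : ℝ × Plane × Plane => f z.1 z.2.1 z.2.2) x hd.hasFDerivAt h1
  have hp : HasFDerivAt (fun q => f t x q) _ p := HasFDerivAt.comp
    (g := fun z : ℝ × Plane × Plane => f z.1 z.2.1 z.2.2) p hd.hasFDerivAt h2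
  rw [inner_gradient_right, inner_gradient_right, hx.fderiv, hp.fderiv] at h
  simp only [ContinuousLinearMap.comp_apply, ContinuousLinearMap.prod_apply, conj_trivial,
    _root_.zero_apply, ContinuousLinearMap.id_apply] at h
  rw [← map_add, ← map_add] at h
  simpa [lorentz] using h

theorem IsSolution.fderiv_electric_zero (hr : IsRegular T f E B)
    (hs : IsSolution T U f₀ E₀ B₀ f E B) {t : ℝ} (ht : t ∈ Ioo 0 T) (x : Plane) :
    fderiv ℝ (fun z : ℝ × Plane => E z.1 z.2 0) (t, x) (1, 0)
      - fderiv ℝ (fun z : ℝ × Plane => B z.1 z.2) (t, x) (0, EuclideanSpace.single 1 1)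
      = -currentDensity (f t) x 0 - U t x 0 := by
  have h1 := timeDeriv_eq_fderiv ht (differentiableAt_of_contDiffOn_Icc two_ne_zero
    (hr.contDiffOn_electric_apply 0) ht x)
  have h2 := fderiv_slice (differentiableAt_of_contDiffOn_Icc two_ne_zero
    hr.magnetic ht x) (EuclideanSpace.single 1 1)
  rw [← h1, ← h2]
  exact hs.ampere₁ t (Ioo_subset_Icc_self ht) x

theorem IsSolution.fderiv_electric_one (hr : IsRegular T f E B)
    (hs : IsSolution T U f₀ E₀ B₀ f E B) {t : ℝ} (ht : t ∈ Ioo 0 T) (x : Plane) :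
    fderiv ℝ (fun z : ℝ × Plane => E z.1 z.2 1) (t, x) (1, 0)
      + fderiv ℝ (fun z : ℝ × Plane => B z.1 z.2) (t, x) (0, EuclideanSpace.single 0 1)
      = -currentDensity (f t) x 1 - U t x 1 := by
  have h1 := timeDeriv_eq_fderiv ht (differentiableAt_of_contDiffOn_Icc two_ne_zero
    (hr.contDiffOn_electric_apply 1) ht x)
  have h2 := fderiv_slice (differentiableAt_of_contDiffOn_Icc two_ne_zero
    hr.magnetic ht x) (EuclideanSpace.single 0 1)
  rw [← h1, ← h2]
  exact hs.ampere₂ t (Ioo_subset_Icc_self ht) x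

theorem IsSolution.fderiv_magnetic (hr : IsRegular T f E B)
    (hs : IsSolution T U f₀ E₀ B₀ f E B) {t : ℝ} (ht : t ∈ Ioo 0 T) (x : Plane) :
    fderiv ℝ (fun z : ℝ × Plane => B z.1 z.2) (t, x) (1, 0)
      + fderiv ℝ (fun z : ℝ × Plane => E z.1 z.2 1) (t, x) (0, EuclideanSpace.single 0 1)
      - fderiv ℝ (fun z : ℝ × Plane => E z.1 z.2 0) (t, x) (0, EuclideanSpace.single 1 1) = 0 := by
  have h1 := timeDeriv_eq_fderiv ht (differentiableAt_of_contDiffOn_Icc two_ne_zero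
    hr.magnetic ht x)
  have h2 := fderiv_slice (differentiableAt_of_contDiffOn_Icc two_ne_zero
    (hr.contDiffOn_electric_apply 1) ht x) (EuclideanSpace.single 0 1)
  have h3 := fderiv_slice (differentiableAt_of_contDiffOn_Icc two_ne_zero
    (hr.contDiffOn_electric_apply 0) ht x) (EuclideanSpace.single 1 1)
  rw [← h1, ← h2, ← h3]
  exact hs.faraday t (Ioo_subset_Icc_self ht) x

/-- The momentum support of a solution is bounded, locally uniformly in space. -/
theorem IsSolution.exists_momentum_bound (hr : IsRegular T f E B)
    (hs : IsSolution T U f₀ E₀ B₀ f E B)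
    (hf₀ : HasCompactSupport (fun z : Plane × Plane => f₀ z.1 z.2)) (a : ℝ) :
    ∃ P, ∀ t ∈ Ico 0 T, ∀ x p : Plane, ‖x‖ ≤ a → P < ‖p‖ → f t x p = 0 := by
  obtain ⟨CE, hCE⟩ := (isCompact_Icc.prod
    (isCompact_closedBall (0 : Plane) (a + T))).exists_bound_of_continuousOn
    (hr.electric.continuousOn.mono (prod_mono le_rfl (subset_univ _)))
  obtain ⟨CB, hCB⟩ := (isCompact_Icc.prod
    (isCompact_closedBall (0 : Plane) (a + T))).exists_bound_of_continuousOn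
    (hr.magnetic.continuousOn.mono (prod_mono le_rfl (subset_univ _)))
  obtain ⟨R, hR⟩ := hf₀.isCompact.isBounded.exists_norm_le
  have hR' : ∀ y q : Plane, R < ‖q‖ → f₀ y q = 0 := by
    intro y q hq
    by_contra hne
    have := hR (y, q) (subset_tsupport _ hne)
    exact absurd ((norm_snd_le (y, q)).trans this) (not_le.2 hq)
  -- `R` bounds the initial momenta and `CE + CB` the force on the ball of radius `a + T`, which
  -- contains the backward light cone of every point with `‖x‖ ≤ a`.
  refine ⟨R + (CE + CB) * T, fun t ht x p hx hp => ?_⟩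
  have hbound : ∀ s ∈ Icc 0 t, ∀ y q : Plane, ‖y - x‖ ≤ t →
      ‖lorentz (E s y) (B s y) q‖ ≤ CE + CB := by
    intro s hs y q hy
    have hmem : (s, y) ∈ Icc 0 T ×ˢ Metric.closedBall (0 : Plane) (a + T) := by
      refine ⟨⟨hs.1, hs.2.trans ht.2.le⟩, mem_closedBall_zero_iff.2 ?_⟩
      have := norm_add_le (y - x) x
      rw [sub_add_cancel] at this
      linarith [ht.2]
    have h1 : ‖E s y‖ ≤ CE := hCE (s, y) hmem
    have h2 : ‖B s y‖ ≤ CB := hCB (s, y) hmem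
    rw [Real.norm_eq_abs] at h2
    exact (norm_lorentz_le _ _ _).trans (add_le_add h1 h2)
  have hK : 0 ≤ CE + CB :=
    (norm_nonneg _).trans (hbound 0 ⟨le_rfl, ht.1⟩ x p (by simpa using ht.1))
  have hbase : ∀ y q : Plane, ‖q - p‖ ≤ (CE + CB) * t → f 0 y q = 0 := by
    intro y q hq
    rw [hs.initial_density]
    refine hR' y q ?_
    have h1 := norm_sub_norm_le p q
    rw [norm_sub_rev] at h1
    nlinarith [mul_le_mul_of_nonneg_left ht.2.le hK]
  have hIoo : ∀ s ∈ Ioc 0 t, s ∈ Ioo 0 T := fun s hs => ⟨hs.1, hs.2.trans_lt ht.2⟩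
  have hcont := hr.density.continuousOn.mono
    (prod_mono (Icc_subset_Icc_right ht.2.le) (le_refl univ))
  have hd : ∀ s ∈ Ioc 0 t, ∀ w : Plane × Plane,
      DifferentiableAt ℝ (fun z : ℝ × Plane × Plane => f z.1 z.2.1 z.2.2) (s, w) :=
    fun s hs w => differentiableAt_of_contDiffOn_Icc one_ne_zero hr.density (hIoo s hs) w
  -- Both `f` and `-f` are transported and vanish on the base of the cone, so each is nonpositive at
  -- the apex.
  refine le_antisymm ?_ (neg_nonpos.1 ?_)
  · exact transport_nonpos_of_cone
      (φ := fun z : ℝ × Plane × Plane => f z.1 z.2.1 z.2.2) (K := CE + CB)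
      (v := fun z => (velocity z.2.2, lorentz (E z.1 z.2.1) (B z.1 z.2.1) z.2.2)) ht.1 hcont hd
      (fun s h w => hs.fderiv_density hr (hIoo s h) w.1 w.2) (fun _ _ _ => norm_velocity_le _)
      hbound (fun y q _ hq => (hbase y q hq).le)
  · refine transport_nonpos_of_cone
      (φ := fun z : ℝ × Plane × Plane => -f z.1 z.2.1 z.2.2) (K := CE + CB)
      (v := fun z => (velocity z.2.2, lorentz (E z.1 z.2.1) (B z.1 z.2.1) z.2.2)) ht.1 hcont.neg
      (fun s h w => (hd s h w).neg) (fun s h w => ?_) (fun _ _ _ => norm_velocity_le _)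
      hbound (fun y q _ hq => by simp [hbase y q hq])
    rw [fderiv_fun_neg, _root_.neg_apply, hs.fderiv_density hr (hIoo s h) w.1 w.2, neg_zero]

end Solution

/-! ### Incompressibility of the phase space flow -/

instance : (volume : Measure (Plane × Plane)).IsAddHaarMeasure :=
  inferInstanceAs ((volume : Measure Plane).prod volume).IsAddHaarMeasure

/-- The phase space vector field `(p̂, E - p̂^⊥ B)` is divergence free. -/
theorem integral_fderiv_lorentz_eq_zero {κ : Plane × Plane → ℝ} {K : Set (Plane × Plane)}
    {E : Plane → Plane} {B : Plane → ℝ} (hκ : ContDiff ℝ 1 κ) (hK : IsCompact K)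
    (h0 : ∀ w ∉ K, κ w = 0) (hE : ContDiff ℝ 1 E) (hB : ContDiff ℝ 1 B) :
    ∫ w, fderiv ℝ κ w (velocity w.2, lorentz (E w.1) (B w.1) w.2) = 0 := by
  let c : Fin 4 → Plane × Plane → ℝ := ![fun w => velocity w.2 0, fun w => velocity w.2 1,
    fun w => E w.1 0 + B w.1 * velocity w.2 1, fun w => E w.1 1 - B w.1 * velocity w.2 0]
  let d : Fin 4 → Plane × Plane := ![(EuclideanSpace.single 0 1, 0),
    (EuclideanSpace.single 1 1, 0), (0, EuclideanSpace.single 0 1), (0, EuclideanSpace.single 1 1)]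
  have hv : ∀ i, ContDiff ℝ 1 fun q => velocity q i := fun i =>
    (EuclideanSpace.proj i : Plane →L[ℝ] ℝ).contDiff.comp contDiff_velocity
  have hEi : ∀ i, ContDiff ℝ 1 fun y => E y i := fun i =>
    (EuclideanSpace.proj i : Plane →L[ℝ] ℝ).contDiff.comp hE
  have hvs : ∀ i, ContDiff ℝ 1 fun w : Plane × Plane => velocity w.2 i := fun i =>
    (hv i).comp contDiff_snd
  have hF0 : ContDiff ℝ 1 fun w : Plane × Plane => E w.1 0 + B w.1 * velocity w.2 1 :=
    ((hEi 0).comp contDiff_fst).add ((hB.comp contDiff_fst).mul (hvs 1))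
  have hF1 : ContDiff ℝ 1 fun w : Plane × Plane => E w.1 1 - B w.1 * velocity w.2 0 :=
    ((hEi 1).comp contDiff_fst).sub ((hB.comp contDiff_fst).mul (hvs 0))
  have hexp : ∀ w : Plane × Plane,
      fderiv ℝ κ w (velocity w.2, lorentz (E w.1) (B w.1) w.2)
        = ∑ i : Fin 4, c i w * fderiv ℝ κ w (d i) := by
    intro w
    simp only [Fin.sum_univ_four, c, d, Matrix.cons_val]
    rw [← lorentz_zero, ← lorentz_one]
    simp only [← smul_eq_mul, ← map_smul, ← map_add]
    congr 1
    simp only [Prod.smul_mk, smul_zero, Prod.mk_add_mk, add_zero, zero_add, ← eq_sum_single]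
  have hc : ∀ i, ContDiff ℝ 1 (c i) := by
    intro i
    fin_cases i
    exacts [hvs 0, hvs 1, hF0, hF1]
  simp only [hexp]
  rw [integral_sum_mul_fderiv_eq_neg hc hκ hK h0, neg_eq_zero]
  have hdv : ∀ (i : Fin 2) (w : Plane × Plane), HasFDerivAt (fun w : Plane × Plane =>
      velocity w.2 i) ((fderiv ℝ (fun q => velocity q i) w.2).comp
        (ContinuousLinearMap.snd ℝ Plane Plane)) w := fun i w =>
    ((hv i).differentiable (by simp) w.2).hasFDerivAt.comp w hasFDerivAt_snd
  have hdx : ∀ {h : Plane → ℝ}, ContDiff ℝ 1 h → ∀ w : Plane × Plane,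
      HasFDerivAt (fun w : Plane × Plane => h w.1) ((fderiv ℝ h w.1).comp
        (ContinuousLinearMap.fst ℝ Plane Plane)) w := fun hh w =>
    (hh.differentiable (by simp) w.1).hasFDerivAt.comp w hasFDerivAt_fst
  refine integral_eq_zero_of_ae (Filter.Eventually.of_forall fun w => ?_)
  have h2 := ((hdx (hEi 0) w).add ((hdx hB w).mul (hdv 1 w))).fderiv
  have h3 := ((hdx (hEi 1) w).sub ((hdx hB w).mul (hdv 0 w))).fderiv
  have h4 := curl_velocity w.2
  -- The velocity does not depend on `x` nor `E`, `B` on `p`; what remains is `B` times the curl of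
  -- the velocity.
  have hsum : fderiv ℝ (c 0) w (d 0) + fderiv ℝ (c 1) w (d 1) + fderiv ℝ (c 2) w (d 2)
      + fderiv ℝ (c 3) w (d 3) = 0 := by
    rw [show fderiv ℝ (c 0) w = _ from (hdv 0 w).fderiv,
      show fderiv ℝ (c 1) w = _ from (hdv 1 w).fderiv, show fderiv ℝ (c 2) w = _ from h2,
      show fderiv ℝ (c 3) w = _ from h3]
    simp [d, h4]
  simp only [Fin.sum_univ_four, Pi.zero_apply, ← add_mul, hsum, zero_mul]

theorem contDiff_slice {X Z : Type*} [NormedAddCommGroup X] [NormedSpace ℝ X]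
    [NormedAddCommGroup Z] [NormedSpace ℝ Z] {n : WithTop ℕ∞} {I : Set ℝ} {h : ℝ × X → Z}
    (hh : ContDiffOn ℝ n h (I ×ˢ univ)) {t : ℝ} (ht : t ∈ I) : ContDiff ℝ n fun x => h (t, x) :=
  hh.comp_contDiff (contDiff_prodMk_right t) fun x => ⟨ht, mem_univ x⟩

theorem differentiableAt_of_contDiffOn_Ioo {X Z : Type*} [NormedAddCommGroup X] [NormedSpace ℝ X]
    [NormedAddCommGroup Z] [NormedSpace ℝ Z] {T : ℝ} {h : ℝ × X → Z}
    (hh : ContDiffOn ℝ 1 h (Ioo 0 T ×ˢ univ)) {t : ℝ} (ht : t ∈ Ioo 0 T) (x : X) :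
    DifferentiableAt ℝ h (t, x) :=
  (hh.differentiableOn one_ne_zero).differentiableAt
    ((isOpen_Ioo.prod isOpen_univ).mem_nhds ⟨ht, mem_univ x⟩)

theorem continuous_fderiv_slice {X Z : Type*} [NormedAddCommGroup X] [NormedSpace ℝ X]
    [NormedAddCommGroup Z] [NormedSpace ℝ Z] {T : ℝ} {h : ℝ × X → Z}
    (hh : ContDiffOn ℝ 1 h (Ioo 0 T ×ˢ univ)) {t : ℝ} (ht : t ∈ Ioo 0 T) :
    Continuous fun x => fderiv ℝ h (t, x) :=
  (hh.continuousOn_fderiv_of_isOpen (isOpen_Ioo.prod isOpen_univ) le_rfl).comp_continuous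
    (by fun_prop) fun x => ⟨ht, mem_univ x⟩

theorem norm_sq_eq (a : Plane) : ‖a‖ ^ 2 = a 0 ^ 2 + a 1 ^ 2 := by
  simp [EuclideanSpace.norm_sq_eq, Fin.sum_univ_two]

/-! ### Weighted energy for the Maxwell equations -/

section Maxwell

variable {W e₀ e₁ b : ℝ × Plane → ℝ}

/-- Pointwise form of the weighted energy inequality for the Maxwell equations. -/
theorem fderiv_maxwell_energy_le {z : ℝ × Plane} {J₀ J₁ : ℝ}
    (hW : DifferentiableAt ℝ W z) (he₀ : DifferentiableAt ℝ e₀ z) (he₁ : DifferentiableAt ℝ e₁ z)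
    (hb : DifferentiableAt ℝ b z)
    (hcone : ∀ r y, ‖y‖ ≤ r → fderiv ℝ W z (r, y) ≤ 0)
    (h₀ : fderiv ℝ e₀ z (1, 0) - fderiv ℝ b z (0, EuclideanSpace.single 1 1) = -J₀)
    (h₁ : fderiv ℝ e₁ z (1, 0) + fderiv ℝ b z (0, EuclideanSpace.single 0 1) = -J₁)
    (h₂ : fderiv ℝ b z (1, 0) + fderiv ℝ e₁ z (0, EuclideanSpace.single 0 1)
      - fderiv ℝ e₀ z (0, EuclideanSpace.single 1 1) = 0) :
    fderiv ℝ (fun z => W z * (e₀ z ^ 2 + e₁ z ^ 2 + b z ^ 2)) z (1, 0)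
      ≤ 2 * fderiv ℝ (fun z => W z * (e₀ z * b z)) z (0, EuclideanSpace.single 1 1)
        - 2 * fderiv ℝ (fun z => W z * (e₁ z * b z)) z (0, EuclideanSpace.single 0 1)
        - 2 * (W z * (e₀ z * J₀ + e₁ z * J₁)) := by
  have dm := (hW.hasFDerivAt.mul (((he₀.hasFDerivAt.pow 2).add (he₁.hasFDerivAt.pow 2)).add
    (hb.hasFDerivAt.pow 2))).fderiv
  have d0 := (hW.hasFDerivAt.mul (he₀.hasFDerivAt.mul hb.hasFDerivAt)).fderiv
  have d1 := (hW.hasFDerivAt.mul (he₁.hasFDerivAt.mul hb.hasFDerivAt)).fderiv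
  rw [show fderiv ℝ (fun z => W z * (e₀ z ^ 2 + e₁ z ^ 2 + b z ^ 2)) z = _ from dm,
    show fderiv ℝ (fun z => W z * (e₀ z * b z)) z = _ from d0,
    show fderiv ℝ (fun z => W z * (e₁ z * b z)) z = _ from d1]
  set q : ℝ := e₀ z ^ 2 + e₁ z ^ 2 + b z ^ 2 with hq
  -- `(q, y)` is the energy density with its Poynting flux. The terms with derivatives of `W`
  -- combine to `fderiv ℝ W z (q, y)`, which has a sign because `‖y‖ = 2 |b| |e| ≤ q`.
  set y : Plane := (2 * b z * e₁ z) • EuclideanSpace.single 0 1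
    - (2 * b z * e₀ z) • EuclideanSpace.single 1 1 with hy
  have hyq : ‖y‖ ≤ q := by
    refine abs_le_of_sq_le_sq' ?_ (by positivity) |>.2
    rw [norm_sq_eq]
    simp [hy]
    nlinarith [sq_nonneg (e₀ z ^ 2 + e₁ z ^ 2 - b z ^ 2)]
  have hle := hcone q y hyq
  have hsplit : ((q, y) : ℝ × Plane) = q • ((1 : ℝ), (0 : Plane))
      + (2 * b z * e₁ z) • ((0 : ℝ), (EuclideanSpace.single 0 1 : Plane))
      - (2 * b z * e₀ z) • ((0 : ℝ), (EuclideanSpace.single 1 1 : Plane)) := by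
    simp [hy]
  rw [hsplit, map_sub, map_add, map_smul, map_smul, map_smul] at hle
  have h₀' := eq_add_of_sub_eq h₀
  have h₁' := eq_sub_of_add_eq h₁
  have h₂' := eq_sub_of_add_eq (eq_of_sub_eq_zero h₂)
  simp only [smul_eq_mul, _root_.add_apply, _root_.smul_apply, h₀', h₁', h₂'] at hle ⊢
  simp
  linarith

/-- Weighted energy inequality for the Maxwell equations with current `J`. -/
theorem integral_fderiv_maxwell_energy_le {T t : ℝ} {K : Set Plane} {J₀ J₁ : Plane → ℝ}
    (hW : ContDiff ℝ 1 W) (he₀ : ContDiffOn ℝ 1 e₀ (Ioo 0 T ×ˢ univ))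
    (he₁ : ContDiffOn ℝ 1 e₁ (Ioo 0 T ×ˢ univ)) (hb : ContDiffOn ℝ 1 b (Ioo 0 T ×ˢ univ))
    (ht : t ∈ Ioo 0 T) (hK : IsCompact K) (hWK : ∀ s ∈ Ioo 0 T, ∀ x ∉ K, W (s, x) = 0)
    (hcone : ∀ z r y, ‖y‖ ≤ r → fderiv ℝ W z (r, y) ≤ 0)
    (h₀ : ∀ x, fderiv ℝ e₀ (t, x) (1, 0) - fderiv ℝ b (t, x) (0, EuclideanSpace.single 1 1)
      = -J₀ x)
    (h₁ : ∀ x, fderiv ℝ e₁ (t, x) (1, 0) + fderiv ℝ b (t, x) (0, EuclideanSpace.single 0 1)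
      = -J₁ x)
    (h₂ : ∀ x, fderiv ℝ b (t, x) (1, 0) + fderiv ℝ e₁ (t, x) (0, EuclideanSpace.single 0 1)
      - fderiv ℝ e₀ (t, x) (0, EuclideanSpace.single 1 1) = 0)
    (hJ : Integrable fun x => 2 * (W (t, x) * (e₀ (t, x) * J₀ x + e₁ (t, x) * J₁ x))) :
    ∫ x, fderiv ℝ (fun z => W z * (e₀ z ^ 2 + e₁ z ^ 2 + b z ^ 2)) (t, x) (1, 0)
      ≤ -∫ x, 2 * (W (t, x) * (e₀ (t, x) * J₀ x + e₁ (t, x) * J₁ x)) := by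
  have hm : ContDiffOn ℝ 1 (fun z => W z * (e₀ z ^ 2 + e₁ z ^ 2 + b z ^ 2)) (Ioo 0 T ×ˢ univ) :=
    hW.contDiffOn.mul (((he₀.pow 2).add (he₁.pow 2)).add (hb.pow 2))
  have hu₀ : ContDiffOn ℝ 1 (fun z => W z * (e₀ z * b z)) (Ioo 0 T ×ˢ univ) :=
    hW.contDiffOn.mul (he₀.mul hb)
  have hu₁ : ContDiffOn ℝ 1 (fun z => W z * (e₁ z * b z)) (Ioo 0 T ×ˢ univ) :=
    hW.contDiffOn.mul (he₁.mul hb)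
  have hint : ∀ {u v : ℝ × Plane → ℝ}, (∀ z, u z = W z * v z) →
      ContDiffOn ℝ 1 u (Ioo 0 T ×ˢ univ) → ∀ d, Integrable fun x => fderiv ℝ u (t, x) d := by
    intro u v huv hu d
    refine integrable_of_continuous_of_zero_off
      ((continuous_fderiv_slice hu ht).clm_apply continuous_const) hK fun x hx => ?_
    rw [fderiv_eq_zero_of_zero_off hK (fun s hs x hx => by rw [huv, hWK s hs x hx, zero_mul])
      ht x hx, _root_.zero_apply]
  have hzero : ∀ {u v : ℝ × Plane → ℝ}, (∀ z, u z = W z * v z) →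
      ContDiffOn ℝ 1 u (Ioo 0 T ×ˢ univ) → ∀ d, ∫ x, fderiv ℝ u (t, x) (0, d) = 0 := by
    intro u v huv hu d
    have := integral_fderiv_apply_eq_zero (μ := volume) (contDiff_slice hu ht) hK
      (fun x hx => by rw [huv, hWK t ht x hx, zero_mul]) d
    simpa only [fderiv_slice (differentiableAt_of_contDiffOn_Ioo hu ht _)] using this
  have hi₀ := (hint (fun _ => rfl) hu₀ (0, EuclideanSpace.single 1 1)).const_mul 2
  have hi₁ := (hint (fun _ => rfl) hu₁ (0, EuclideanSpace.single 0 1)).const_mul 2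
  have hi₂ := hi₀.sub hi₁
  rw [Pi.sub_def] at hi₂
  -- The flux terms are spatial derivatives of compactly supported functions and integrate to zero.
  refine (integral_mono (hint (fun _ => rfl) hm (1, 0)) (hi₂.sub hJ) fun x =>
    fderiv_maxwell_energy_le (hW.differentiable one_ne_zero _)
      (differentiableAt_of_contDiffOn_Ioo he₀ ht x) (differentiableAt_of_contDiffOn_Ioo he₁ ht x)
      (differentiableAt_of_contDiffOn_Ioo hb ht x) (hcone _) (h₀ x) (h₁ x) (h₂ x)).trans_eq ?_
  simp only [Pi.sub_apply]
  rw [integral_sub hi₂ hJ, integral_sub hi₀ hi₁, integral_const_mul, integral_const_mul,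
    hzero (fun _ => rfl) hu₀, hzero (fun _ => rfl) hu₁]
  simp

end Maxwell

/-! ### Weighted energy for the transport equation -/

/-- Along the flow of `(p̂, E - p̂^⊥ B)` the total time derivative may replace the partial one. -/
theorem integral_fderiv_eq_integral_fderiv_flow {T t : ℝ} {k : ℝ × Plane × Plane → ℝ}
    {K : Set (Plane × Plane)} {E : Plane → Plane} {B : Plane → ℝ}
    (hk : ContDiffOn ℝ 1 k (Ioo 0 T ×ˢ univ)) (ht : t ∈ Ioo 0 T) (hK : IsCompact K)
    (h0 : ∀ s ∈ Ioo 0 T, ∀ w ∉ K, k (s, w) = 0) (hE : ContDiff ℝ 1 E) (hB : ContDiff ℝ 1 B) :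
    Integrable (fun w : Plane × Plane =>
      fderiv ℝ k (t, w) (1, velocity w.2, lorentz (E w.1) (B w.1) w.2)) ∧
    ∫ w, fderiv ℝ k (t, w) (1, 0)
      = ∫ w : Plane × Plane,
        fderiv ℝ k (t, w) (1, velocity w.2, lorentz (E w.1) (B w.1) w.2) := by
  have hperp : ContDiff ℝ 1 fun w : Plane × Plane => perp (velocity w.2) := by
    rw [contDiff_euclidean]
    have hv : ∀ i, ContDiff ℝ 1 fun w : Plane × Plane => velocity w.2 i := fun i =>
      (EuclideanSpace.proj i : Plane →L[ℝ] ℝ).contDiff.comp (contDiff_velocity.comp contDiff_snd)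
    intro i
    fin_cases i
    · exact (hv 1).neg
    · exact hv 0
  have hF : Continuous fun w : Plane × Plane => lorentz (E w.1) (B w.1) w.2 :=
    (hE.continuous.comp continuous_fst).sub
      ((hB.continuous.comp continuous_fst).smul hperp.continuous)
  have hv : Continuous fun w : Plane × Plane => velocity w.2 :=
    (contDiff_velocity (n := 1)).continuous.comp continuous_snd
  have hint : ∀ {d : Plane × Plane → ℝ × Plane × Plane}, Continuous d →
      Integrable fun w => fderiv ℝ k (t, w) (d w) := fun hd =>
    integrable_of_continuous_of_zero_off ((continuous_fderiv_slice hk ht).clm_apply hd) hK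
      fun w hw => by rw [fderiv_eq_zero_of_zero_off hK h0 ht w hw, _root_.zero_apply]
  have hi := hint ((continuous_const (y := (1 : ℝ))).prodMk (hv.prodMk hF))
  refine ⟨hi, ?_⟩
  have hz := integral_fderiv_lorentz_eq_zero (contDiff_slice hk ht) hK (h0 t ht) hE hB
  simp only [fderiv_slice (differentiableAt_of_contDiffOn_Ioo hk ht _)] at hz
  rw [← sub_eq_zero, ← integral_sub (hint continuous_const) hi, ← neg_eq_zero, ← integral_neg,
    ← hz]
  refine integral_congr_ae (Filter.Eventually.of_forall fun w => ?_)
  simp only [← map_sub, ← map_neg]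
  simp

/-- The pointwise estimate for the transport part of the energy. -/
theorem fderiv_transport_energy_le {W : ℝ × Plane → ℝ} {g : ℝ × Plane × Plane → ℝ}
    {t : ℝ} {x p F e : Plane} {S b M χ : ℝ} (hW : DifferentiableAt ℝ W (t, x))
    (hg : DifferentiableAt ℝ g (t, x, p)) (hW0 : 0 ≤ W (t, x))
    (hcone : ∀ r y, ‖y‖ ≤ r → fderiv ℝ W (t, x) (r, y) ≤ 0)
    (heq : fderiv ℝ g (t, x, p) (1, velocity p, F) = -S) (hM : 0 ≤ M) (hχ : 0 ≤ χ)
    (hS : W (t, x) ≠ 0 → g (t, x, p) ≠ 0 → |S| ≤ M * (‖e‖ + |b|) ∧ 1 ≤ χ) :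
    fderiv ℝ (fun z : ℝ × Plane × Plane => W (z.1, z.2.1) * g z ^ 2) (t, x, p)
        (1, velocity p, F)
      - 8 * Real.pi * (W (t, x) * g (t, x, p) * (e 0 * velocity p 0 + e 1 * velocity p 1))
    ≤ (2 * M + 8 * Real.pi) * (W (t, x) * g (t, x, p) ^ 2
      + W (t, x) * (e 0 ^ 2 + e 1 ^ 2 + b ^ 2) * χ) := by
  have hWc : HasFDerivAt (fun z : ℝ × Plane × Plane => W (z.1, z.2.1))
      ((fderiv ℝ W (t, x)).comp ((ContinuousLinearMap.fst ℝ ℝ (Plane × Plane)).prod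
        ((ContinuousLinearMap.fst ℝ Plane Plane).comp
          (ContinuousLinearMap.snd ℝ ℝ (Plane × Plane))))) (t, x, p) :=
    HasFDerivAt.comp (g := W) (t, x, p) hW.hasFDerivAt
      (hasFDerivAt_fst.prodMk (hasFDerivAt_fst.comp (t, x, p) hasFDerivAt_snd))
  have hd := (hWc.mul (hg.hasFDerivAt.pow 2)).fderiv
  rw [show fderiv ℝ (fun z : ℝ × Plane × Plane => W (z.1, z.2.1) * g z ^ 2) (t, x, p) = _ from hd]
  have hdec : fderiv ℝ W (t, x) (1, velocity p) ≤ 0 := hcone _ _ (norm_velocity_le p)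
  set G := g (t, x, p)
  set w := W (t, x)
  have hpi := Real.pi_pos
  have hval : (w • ((2 * G ^ (2 - 1)) • fderiv ℝ g (t, x, p)) + G ^ 2 •
      (fderiv ℝ W (t, x)).comp ((ContinuousLinearMap.fst ℝ ℝ (Plane × Plane)).prod
        ((ContinuousLinearMap.fst ℝ Plane Plane).comp
          (ContinuousLinearMap.snd ℝ ℝ (Plane × Plane))))) (1, velocity p, F)
      = -(2 * w * G * S) + G ^ 2 * fderiv ℝ W (t, x) (1, velocity p) := by
    simp [heq]
    ring
  have hmain : -(2 * w * G * S)
      - 8 * Real.pi * (w * G * (e 0 * velocity p 0 + e 1 * velocity p 1))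
      ≤ (2 * M + 8 * Real.pi) * (w * G ^ 2 + w * (e 0 ^ 2 + e 1 ^ 2 + b ^ 2) * χ) := by
    rw [← norm_sq_eq]
    -- Where `w` or `G` vanishes the left side is zero, so the bounds on `S` and `χ` are needed only
    -- on the support of both.
    by_cases hw : w = 0
    · simp [hw]
    by_cases hG : G = 0
    · simp only [hG, mul_zero, zero_mul, neg_zero, sub_zero]
      positivity
    obtain ⟨hS1, hχ1⟩ := hS hw hG
    have hin : |e 0 * velocity p 0 + e 1 * velocity p 1| ≤ ‖e‖ := by
      have h1 := abs_real_inner_le_norm e (velocity p)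
      rw [show inner ℝ e (velocity p) = e 0 * velocity p 0 + e 1 * velocity p 1 by
        simp [PiLp.inner_apply, Fin.sum_univ_two, mul_comm]] at h1
      exact h1.trans (mul_le_of_le_one_right (norm_nonneg _) (norm_velocity_le p))
    have h1 : -(G * S) ≤ |G| * (M * (‖e‖ + |b|)) := by
      refine (neg_le_abs _).trans ?_
      rw [abs_mul]
      exact mul_le_mul_of_nonneg_left hS1 (abs_nonneg _)
    have h2 : -(G * (e 0 * velocity p 0 + e 1 * velocity p 1)) ≤ |G| * (‖e‖ + |b|) := by
      refine (neg_le_abs _).trans ?_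
      rw [abs_mul]
      exact mul_le_mul_of_nonneg_left (hin.trans (le_add_of_nonneg_right (abs_nonneg _)))
        (abs_nonneg _)
    -- The cross terms `|G| ‖e‖` and `|G| |b|` are split by the arithmetic-geometric mean
    -- inequality.
    have h3 : |G| * (‖e‖ + |b|) ≤ G ^ 2 + (‖e‖ ^ 2 + b ^ 2) := by
      nlinarith [sq_nonneg (|G| - ‖e‖), sq_nonneg (|G| - |b|), sq_abs G, sq_abs b,
        sq_nonneg ‖e‖, sq_nonneg b]
    have h4 : ‖e‖ ^ 2 + b ^ 2 ≤ (‖e‖ ^ 2 + b ^ 2) * χ :=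
      le_mul_of_one_le_right (by positivity) hχ1
    have h5 : -(2 * (G * S)) - 8 * Real.pi * (G * (e 0 * velocity p 0 + e 1 * velocity p 1))
        ≤ (2 * M + 8 * Real.pi) * (G ^ 2 + (‖e‖ ^ 2 + b ^ 2) * χ) := by
      have h6 := mul_le_mul_of_nonneg_left h2 (by positivity : 0 ≤ 8 * Real.pi)
      have h7 := mul_le_mul_of_nonneg_left (h3.trans (add_le_add_right h4 _))
        (by positivity : 0 ≤ 2 * M + 8 * Real.pi)
      linarith
    have h8 := mul_le_mul_of_nonneg_left h5 hW0
    linarith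
  have hval2 := mul_nonpos_of_nonneg_of_nonpos (sq_nonneg G) hdec
  have hval3 := hval
  norm_num at hval3
  norm_num
  linarith

/-- The momentum bound makes both integrals converge; without it a divergent integral would be
assigned the value zero and linearity could fail. -/
theorem currentDensity_sub_apply {g g' : Plane → Plane → ℝ} {x : Plane} {P : ℝ}
    (hg : Continuous (g x)) (hg' : Continuous (g' x)) (h0 : ∀ p, P < ‖p‖ → g x p = 0)
    (h0' : ∀ p, P < ‖p‖ → g' x p = 0) (i : Fin 2) :
    currentDensity g x i - currentDensity g' x i
      = 4 * Real.pi * ∫ p, (g x p - g' x p) * velocity p i := by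
  have hv : Continuous velocity := (contDiff_velocity (n := 1)).continuous
  have hint : ∀ {h : Plane → ℝ}, Continuous h → (∀ p, P < ‖p‖ → h p = 0) →
      Integrable fun p => h p • velocity p := fun hh hz =>
    integrable_of_continuous_of_zero_off (hh.smul hv) (isCompact_closedBall (0 : Plane) P)
      fun p hp => by
        rw [hz p (by simpa using hp), zero_smul]
  have hproj : ∀ {h : Plane → ℝ}, Integrable (fun p => h p • velocity p) →
      (∫ p, h p • velocity p) i = ∫ p, h p * velocity p i := fun hh =>
    ((EuclideanSpace.proj i : Plane →L[ℝ] ℝ).integral_comp_comm hh).symm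
  have hg1 := hint hg h0
  have hg2 := hint hg' h0'
  simp only [currentDensity, PiLp.smul_apply, smul_eq_mul, ← mul_sub]
  rw [← PiLp.sub_apply, ← integral_sub hg1 hg2]
  simp only [← sub_smul]
  rw [hproj]
  refine (hg1.sub hg2).congr (Filter.Eventually.of_forall fun p => ?_)
  simp only [Pi.sub_apply, sub_smul]

/-- The derivative within the closed slab is continuous up to both end times, so the bound is
uniform although the full derivative is only controlled at interior times. -/
theorem exists_fderiv_bound {X : Type*} [NormedAddCommGroup X] [NormedSpace ℝ X] {T : ℝ}
    (hT : 0 < T) {h : ℝ × X → ℝ} (hh : ContDiffOn ℝ 1 h (Icc 0 T ×ˢ univ)) {K : Set X}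
    (hK : IsCompact K) : ∃ M, 0 ≤ M ∧ ∀ t ∈ Ioo 0 T, ∀ x ∈ K, ‖fderiv ℝ h (t, x)‖ ≤ M := by
  have hu : UniqueDiffOn ℝ (Icc 0 T ×ˢ (univ : Set X)) :=
    (uniqueDiffOn_Icc hT).prod uniqueDiffOn_univ
  obtain ⟨M, hM⟩ := (isCompact_Icc.prod hK).exists_bound_of_continuousOn
    ((hh.continuousOn_fderivWithin hu le_rfl).mono (prod_mono le_rfl (subset_univ K)))
  refine ⟨max M 0, le_max_right _ _, fun t ht x hx => ?_⟩
  have h1 := hM (t, x) ⟨Ioo_subset_Icc_self ht, hx⟩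
  rw [fderivWithin_of_mem_nhds (Filter.mem_of_superset
    ((isOpen_Ioo.prod isOpen_univ).mem_nhds (show (t, x) ∈ Ioo 0 T ×ˢ univ from ⟨ht, mem_univ x⟩))
    (prod_mono Ioo_subset_Icc_self le_rfl))] at h1
  exact h1.trans (le_max_left _ _)

/-! ### The combined energy estimate and uniqueness -/

theorem eq_zero_of_integral_eq_zero {X : Type*} [TopologicalSpace X] [T2Space X]
    [MeasurableSpace X] [OpensMeasurableSpace X] {μ : Measure X} [IsFiniteMeasureOnCompacts μ]
    [μ.IsOpenPosMeasure] {u : X → ℝ} {K : Set X} (hu : Continuous u) (hK : IsCompact K)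
    (h0 : ∀ x ∉ K, u x = 0) (hnn : ∀ x, 0 ≤ u x) (hi : ∫ x, u x ∂μ = 0) (x : X) : u x = 0 := by
  have h := (integral_eq_zero_iff_of_nonneg hnn
    (integrable_of_continuous_of_zero_off hu hK h0)).1 hi
  exact congrFun ((hu.ae_eq_iff_eq μ continuous_const).1 h) x

/-- Two solutions agree before the final time. -/
theorem IsSolution.eq_of_mem_Ico {T : ℝ} (hT : 0 < T) {U : ℝ → Plane → Plane}
    {f₀ : Plane → Plane → ℝ} {E₀ : Plane → Plane} {B₀ : Plane → ℝ}
    {f f' : ℝ → Plane → Plane → ℝ} {E E' : ℝ → Plane → Plane} {B B' : ℝ → Plane → ℝ}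
    (hf₀ : HasCompactSupport (fun z : Plane × Plane => f₀ z.1 z.2))
    (hr : IsRegular T f E B) (hr' : IsRegular T f' E' B')
    (hs : IsSolution T U f₀ E₀ B₀ f E B) (hs' : IsSolution T U f₀ E₀ B₀ f' E' B')
    {t : ℝ} (ht : t ∈ Ico 0 T) (x : Plane) :
    (∀ p, f t x p = f' t x p) ∧ E t x = E' t x ∧ B t x = B' t x := by
  -- Any radius above `1 + ‖x‖ + t` makes `W (t, x)` positive.
  obtain ⟨W, hW, hW0, hWa, hWpos, hcone⟩ := exists_cone_weight Plane (2 + ‖x‖ + t)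
  set a := 2 + ‖x‖ + t with ha
  obtain ⟨P₁, hP₁⟩ := hs.exists_momentum_bound hr hf₀ a
  obtain ⟨P₂, hP₂⟩ := hs'.exists_momentum_bound hr' hf₀ a
  set P := max P₁ P₂
  have hP : ∀ s ∈ Ico 0 T, ∀ y p : Plane, ‖y‖ ≤ a → P < ‖p‖ → f s y p = 0 :=
    fun s h y p hy hp => hP₁ s h y p hy ((le_max_left _ _).trans_lt hp)
  have hP' : ∀ s ∈ Ico 0 T, ∀ y p : Plane, ‖y‖ ≤ a → P < ‖p‖ → f' s y p = 0 :=
    fun s h y p hy hp => hP₂ s h y p hy ((le_max_right _ _).trans_lt hp)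
  have hKx : IsCompact (Metric.closedBall (0 : Plane) a) := isCompact_closedBall _ _
  have hKw : IsCompact (Metric.closedBall (0 : Plane) a ×ˢ Metric.closedBall (0 : Plane) P) :=
    hKx.prod (isCompact_closedBall _ _)
  obtain ⟨M, hM0, hM⟩ := exists_fderiv_bound hT hr'.density hKw
  -- A continuous cutoff that is at least one on the momentum support. It keeps the field energy
  -- integrable over phase space, at the price of the factor `∫ χ`.
  set χ : Plane → ℝ := fun p => max 0 (1 + P - ‖p‖) with hχdef
  have hχc : Continuous χ := by fun_prop
  have hχ0 : ∀ p, 0 ≤ χ p := fun p => le_max_left _ _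
  have hχs : ∀ p ∉ Metric.closedBall (0 : Plane) (1 + P), χ p = 0 := by
    intro p hp
    rw [mem_closedBall_zero_iff, not_le] at hp
    exact max_eq_left (by linarith)
  have hχ1 : ∀ p, ‖p‖ ≤ P → 1 ≤ χ p := fun p hp => le_max_of_le_right (by linarith)
  set e₀ : ℝ × Plane → ℝ := fun z => E z.1 z.2 0 - E' z.1 z.2 0 with he₀def
  set e₁ : ℝ × Plane → ℝ := fun z => E z.1 z.2 1 - E' z.1 z.2 1 with he₁def
  set b : ℝ × Plane → ℝ := fun z => B z.1 z.2 - B' z.1 z.2 with hbdef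
  set g : ℝ × Plane × Plane → ℝ := fun z => f z.1 z.2.1 z.2.2 - f' z.1 z.2.1 z.2.2 with hgdef
  set m : ℝ × Plane → ℝ := fun z => W z * (e₀ z ^ 2 + e₁ z ^ 2 + b z ^ 2) with hmdef
  set k : ℝ × Plane × Plane → ℝ := fun z => W (z.1, z.2.1) * g z ^ 2 with hkdef
  have one_le_two' : (1 : WithTop ℕ∞) ≤ 2 := by norm_num
  have he₀ : ContDiffOn ℝ 1 e₀ (Icc 0 T ×ˢ univ) := ((hr.contDiffOn_electric_apply 0).sub
    (hr'.contDiffOn_electric_apply 0)).of_le one_le_two'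
  have he₁ : ContDiffOn ℝ 1 e₁ (Icc 0 T ×ˢ univ) := ((hr.contDiffOn_electric_apply 1).sub
    (hr'.contDiffOn_electric_apply 1)).of_le one_le_two'
  have hb : ContDiffOn ℝ 1 b (Icc 0 T ×ˢ univ) :=
    (hr.magnetic.sub hr'.magnetic).of_le one_le_two'
  have hg : ContDiffOn ℝ 1 g (Icc 0 T ×ˢ univ) := hr.density.sub hr'.density
  have hm : ContDiffOn ℝ 1 m (Icc 0 T ×ˢ univ) :=
    hW.contDiffOn.mul (((he₀.pow 2).add (he₁.pow 2)).add (hb.pow 2))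
  have hWx : ContDiff ℝ 1 fun z : ℝ × Plane × Plane => W (z.1, z.2.1) :=
    hW.comp (contDiff_fst.prodMk (contDiff_fst.comp contDiff_snd))
  have hk : ContDiffOn ℝ 1 k (Icc 0 T ×ˢ univ) := hWx.contDiffOn.mul (hg.pow 2)
  have hIoo : ∀ {X : Type} {s : Set X}, Ioo 0 T ×ˢ s ⊆ Icc 0 T ×ˢ s := fun {_ _} =>
    prod_mono Ioo_subset_Icc_self le_rfl
  have hWK : ∀ s, 0 ≤ s → ∀ y ∉ Metric.closedBall (0 : Plane) a, W (s, y) = 0 := by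
    intro s h y hy
    exact hWa s y h (by simpa using hy)
  have hmK : ∀ s ∈ Ico 0 T, ∀ y ∉ Metric.closedBall (0 : Plane) a, m (s, y) = 0 := by
    intro s h y hy
    simp only [hmdef, hWK s h.1 y hy, zero_mul]
  have hgK : ∀ s ∈ Ico 0 T, ∀ y p : Plane, ‖y‖ ≤ a → P < ‖p‖ → g (s, y, p) = 0 := by
    intro s h y p hy hp
    simp only [hgdef, hP s h y p hy hp, hP' s h y p hy hp, sub_zero]
  have hWgK : ∀ s ∈ Ico 0 T, ∀ w ∉ Metric.closedBall (0 : Plane) a ×ˢ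
      Metric.closedBall (0 : Plane) P, W (s, w.1) * g (s, w) = 0 := by
    rintro s h ⟨y, p⟩ hw
    by_cases hy : y ∈ Metric.closedBall (0 : Plane) a
    · have hp : P < ‖p‖ := by
        by_contra hp
        exact hw ⟨hy, by simpa using hp⟩
      simp only [hgK s h y p (by simpa using hy) hp, mul_zero]
    · simp only [hWK s h.1 y hy, zero_mul]
  have hkK : ∀ s ∈ Ico 0 T, ∀ w ∉ Metric.closedBall (0 : Plane) a ×ˢ
      Metric.closedBall (0 : Plane) P, k (s, w) = 0 := by
    intro s h w hw
    have := hWgK s h w hw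
    simp only [hkdef, sq, ← mul_assoc, this, zero_mul]
  have hm0 : ∀ z, 0 ≤ m z := fun z => mul_nonneg (hW0 z) (by positivity)
  have hk0 : ∀ z, 0 ≤ k z := fun z => mul_nonneg (hW0 _) (by positivity)
  have hIco : ∀ {s}, s ∈ Ioo 0 T → s ∈ Ico 0 T := fun h => Ioo_subset_Ico_self h
  have hslice : ∀ {X : Type} [NormedAddCommGroup X] [NormedSpace ℝ X] {h : ℝ × X → ℝ},
      ContDiffOn ℝ 1 h (Icc 0 T ×ˢ univ) → ∀ s ∈ Icc 0 T, Continuous fun y => h (s, y) :=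
    fun hh s h => (contDiff_slice hh h).continuous
  have henergy : ∀ s ∈ Ioo 0 T, (∫ y, fderiv ℝ m (s, y) (1, 0)) + ∫ w, fderiv ℝ k (s, w) (1, 0)
      ≤ ((2 * M + 8 * Real.pi) * (1 + ∫ p, χ p)) * ((∫ y, m (s, y)) + ∫ w, k (s, w)) := by
    intro s h
    have hsI := Ioo_subset_Icc_self h
    have hv : ∀ i, Continuous fun p => velocity p i := fun i =>
      (EuclideanSpace.proj i : Plane →L[ℝ] ℝ).continuous.comp
        (contDiff_velocity (n := 1)).continuous
    -- The work of the current on the field, before integration in `p`: `8π` is the factor `2` of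
    -- the energy identity times the `4π` of the current. It is kept under the phase space integral
    -- so that it can be estimated together with the transport term.
    set c : Plane × Plane → ℝ := fun w => 8 * Real.pi * (W (s, w.1) * g (s, w) *
      (e₀ (s, w.1) * velocity w.2 0 + e₁ (s, w.1) * velocity w.2 1)) with hcdef
    have hcc : Continuous c := by
      have h1 := (hslice hW.contDiffOn s hsI).comp (continuous_fst (X := Plane) (Y := Plane))
      have h2 := (hslice he₀ s hsI).comp (continuous_fst (X := Plane) (Y := Plane))
      have h3 := (hslice he₁ s hsI).comp (continuous_fst (X := Plane) (Y := Plane))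
      exact continuous_const.mul ((h1.mul (hslice hg s hsI)).mul
        ((h2.mul ((hv 0).comp continuous_snd)).add (h3.mul ((hv 1).comp continuous_snd))))
    have hci : Integrable c := integrable_of_continuous_of_zero_off hcc hKw fun w hw => by
      simp only [hcdef, hWgK s (hIco h) w hw, zero_mul, mul_zero]
    set J : Fin 2 → Plane → ℝ :=
      fun i y => currentDensity (f s) y i - currentDensity (f' s) y i with hJdef
    have hJ : ∀ i, ∀ y : Plane, ‖y‖ ≤ a →
        J i y = 4 * Real.pi * ∫ p, g (s, y, p) * velocity p i := fun i y hy =>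
      currentDensity_sub_apply (P := P)
        ((hslice hr.density s hsI).comp (Continuous.prodMk_right y))
        ((hslice hr'.density s hsI).comp (Continuous.prodMk_right y))
        (hP s (hIco h) y · hy) (hP' s (hIco h) y · hy) i
    have hcJ : ∀ y, ∫ p, c (y, p)
        = 2 * (W (s, y) * (e₀ (s, y) * J 0 y + e₁ (s, y) * J 1 y)) := by
      intro y
      by_cases hy : ‖y‖ ≤ a
      · have hgv : ∀ i, Integrable fun p => g (s, y, p) * velocity p i := fun i =>
          integrable_of_continuous_of_zero_off
            (((hslice hg s hsI).comp (Continuous.prodMk_right y)).mul (hv i))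
            (isCompact_closedBall (0 : Plane) P) fun p hp => by
              rw [hgK s (hIco h) y p hy (by simpa using hp), zero_mul]
        have hexp : ∀ p, c (y, p) = 8 * Real.pi * W (s, y) * e₀ (s, y) *
            (g (s, y, p) * velocity p 0) + 8 * Real.pi * W (s, y) * e₁ (s, y) *
            (g (s, y, p) * velocity p 1) := fun p => by
          simp only [hcdef]
          ring
        simp only [hexp]
        rw [integral_add ((hgv 0).const_mul _) ((hgv 1).const_mul _), integral_const_mul,
          integral_const_mul, hJ 0 y hy, hJ 1 y hy]
        ring
      · simp only [hcdef, hWa s y h.1.le (not_le.1 hy), zero_mul, mul_zero, integral_zero]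
    have hcprod : ∫ w, c w = ∫ y, 2 * (W (s, y) * (e₀ (s, y) * J 0 y + e₁ (s, y) * J 1 y)) := by
      simp only [← hcJ]
      exact integral_prod c hci
    have hdE : ∀ i y, DifferentiableAt ℝ (fun z : ℝ × Plane => E z.1 z.2 i) (s, y) := fun i y =>
      differentiableAt_of_contDiffOn_Icc two_ne_zero (hr.contDiffOn_electric_apply i) h y
    have hdE' : ∀ i y, DifferentiableAt ℝ (fun z : ℝ × Plane => E' z.1 z.2 i) (s, y) := fun i y =>
      differentiableAt_of_contDiffOn_Icc two_ne_zero (hr'.contDiffOn_electric_apply i) h y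
    have hde₀ : ∀ y, fderiv ℝ e₀ (s, y) = _ := fun y => fderiv_fun_sub (hdE 0 y) (hdE' 0 y)
    have hde₁ : ∀ y, fderiv ℝ e₁ (s, y) = _ := fun y => fderiv_fun_sub (hdE 1 y) (hdE' 1 y)
    have hdb : ∀ y, fderiv ℝ b (s, y) = _ := fun y => fderiv_fun_sub
      (differentiableAt_of_contDiffOn_Icc two_ne_zero hr.magnetic h y)
      (differentiableAt_of_contDiffOn_Icc two_ne_zero hr'.magnetic h y)
    have hmax : ∫ y, fderiv ℝ m (s, y) (1, 0) ≤ -∫ w, c w := by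
      rw [hcprod]
      refine integral_fderiv_maxwell_energy_le hW (he₀.mono hIoo) (he₁.mono hIoo) (hb.mono hIoo)
        h hKx (fun r hr => hWK r hr.1.le) hcone (fun y => ?_) (fun y => ?_) (fun y => ?_) ?_
      · rw [hde₀, hdb, _root_.sub_apply, _root_.sub_apply]
        have h1 := hs.fderiv_electric_zero hr h y
        have h2 := hs'.fderiv_electric_zero hr' h y
        simp only [hJdef]
        linarith
      · rw [hde₁, hdb, _root_.sub_apply, _root_.sub_apply]
        have h1 := hs.fderiv_electric_one hr h y
        have h2 := hs'.fderiv_electric_one hr' h y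
        simp only [hJdef]
        linarith
      · rw [hde₀, hde₁, hdb, _root_.sub_apply, _root_.sub_apply, _root_.sub_apply]
        have h1 := hs.fderiv_magnetic hr h y
        have h2 := hs'.fderiv_magnetic hr' h y
        linarith
      · simp only [← hcJ]
        exact Integrable.integral_prod_left (f := c) hci
    obtain ⟨hki, hkeq⟩ := integral_fderiv_eq_integral_fderiv_flow (hk.mono hIoo) h hKw
      (fun r hr => hkK r (hIco hr)) (E := E s) (B := B s)
      (contDiff_slice (hr.electric.of_le one_le_two') hsI)
      (contDiff_slice (hr.magnetic.of_le one_le_two') hsI)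
    have hmχi : Integrable fun w : Plane × Plane => m (s, w.1) * χ w.2 :=
      Integrable.mul_prod
        (integrable_of_continuous_of_zero_off (hslice hm s hsI) hKx (hmK s (hIco h)))
        (integrable_of_continuous_of_zero_off hχc (isCompact_closedBall _ _) hχs)
    have hksi : Integrable fun w => k (s, w) :=
      integrable_of_continuous_of_zero_off (hslice hk s hsI) hKw (hkK s (hIco h))
    have hpt : ∀ w : Plane × Plane,
        fderiv ℝ k (s, w) (1, velocity w.2, lorentz (E s w.1) (B s w.1) w.2) - c w
          ≤ (2 * M + 8 * Real.pi) * (k (s, w) + m (s, w.1) * χ w.2) := by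
      rintro ⟨y, p⟩
      have hd := differentiableAt_of_contDiffOn_Icc one_ne_zero hr.density h (y, p)
      have hd' := differentiableAt_of_contDiffOn_Icc one_ne_zero hr'.density h (y, p)
      have hdg : fderiv ℝ g (s, y, p) = _ := fderiv_fun_sub hd hd'
      -- Along the flow of the first solution `f` is constant, while `f'` is constant along its own
      -- flow; only the difference of the two forces acting on `f'` survives as the source.
      refine fderiv_transport_energy_le (e := E s y - E' s y) (b := b (s, y))
        (S := fderiv ℝ (fun z : ℝ × Plane × Plane => f' z.1 z.2.1 z.2.2) (s, y, p)
          (0, 0, lorentz (E s y - E' s y) (B s y - B' s y) p))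
        (hW.differentiable one_ne_zero _) (hd.sub hd') (hW0 _) (hcone _) ?_ hM0 (hχ0 p) ?_
      · have h1 := hs.fderiv_density hr h y p
        have h2 := hs'.fderiv_density hr' h y p
        have h3 : fderiv ℝ (fun z : ℝ × Plane × Plane => f' z.1 z.2.1 z.2.2) (s, y, p)
            (0, 0, lorentz (E s y) (B s y) p - lorentz (E' s y) (B' s y) p)
            = fderiv ℝ (fun z : ℝ × Plane × Plane => f' z.1 z.2.1 z.2.2) (s, y, p)
                (1, velocity p, lorentz (E s y) (B s y) p)
              - fderiv ℝ (fun z : ℝ × Plane × Plane => f' z.1 z.2.1 z.2.2) (s, y, p)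
                (1, velocity p, lorentz (E' s y) (B' s y) p) := by
          rw [← map_sub]
          simp
        rw [hdg, _root_.sub_apply, h1, zero_sub, ← lorentz_sub, h3, h2, sub_zero]
      · intro hWne hgne
        have hy : ‖y‖ ≤ a := by
          by_contra hy
          exact hWne (hWa s y h.1.le (not_le.1 hy))
        have hp : ‖p‖ ≤ P := by
          by_contra hp
          exact hgne (hgK s (hIco h) y p hy (not_le.1 hp))
        refine ⟨?_, hχ1 p hp⟩
        rw [← Real.norm_eq_abs]
        refine (ContinuousLinearMap.le_opNorm _ _).trans ?_
        refine mul_le_mul (hM s h (y, p) ⟨by simpa using hy, by simpa using hp⟩) ?_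
          (norm_nonneg _) hM0
        simpa [Prod.norm_def] using norm_lorentz_le (E s y - E' s y) (B s y - B' s y) p
    have hbound := integral_mono (hki.sub hci) ((hksi.add hmχi).const_mul _) hpt
    simp only [Pi.sub_apply, Pi.add_apply] at hbound
    have hright : ∫ w, (2 * M + 8 * Real.pi) * (k (s, w) + m (s, w.1) * χ w.2)
        = (2 * M + 8 * Real.pi) * ((∫ w, k (s, w)) + (∫ y, m (s, y)) * ∫ p, χ p) := by
      rw [integral_const_mul, integral_add hksi hmχi,
        show ∫ w : Plane × Plane, m (s, w.1) * χ w.2 = (∫ y, m (s, y)) * ∫ p, χ p from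
          integral_prod_mul (fun y => m (s, y)) χ]
    rw [integral_sub hki hci, hright, ← hkeq] at hbound
    have hX : 0 ≤ ∫ p, χ p := integral_nonneg hχ0
    have hk1 : 0 ≤ ∫ w, k (s, w) := integral_nonneg fun w => hk0 _
    have hm1 : 0 ≤ ∫ y, m (s, y) := integral_nonneg fun y => hm0 _
    have hC : 0 ≤ 2 * M + 8 * Real.pi := by positivity
    have hfin : (∫ w, k (s, w)) + (∫ y, m (s, y)) * ∫ p, χ p
        ≤ (1 + ∫ p, χ p) * ((∫ y, m (s, y)) + ∫ w, k (s, w)) := by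
      linarith [mul_nonneg hX hk1]
    have := mul_le_mul_of_nonneg_left hfin hC
    rw [← mul_assoc] at this
    linarith
  have hIcc : Icc 0 t ⊆ Icc 0 T := Icc_subset_Icc_right ht.2.le
  have hcont : ContinuousOn (fun s => (∫ y, m (s, y)) + ∫ w, k (s, w)) (Icc 0 t) := by
    refine ContinuousOn.add ?_ ?_
    · exact continuousOn_integral_of_compact_support (f := fun s y => m (s, y)) hKx
        (hm.continuousOn.mono (prod_mono hIcc le_rfl))
        fun s y h hy => hmK s ⟨h.1, h.2.trans_lt ht.2⟩ y hy
    · exact continuousOn_integral_of_compact_support (f := fun s y => k (s, y)) hKw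
        (hk.continuousOn.mono (prod_mono hIcc le_rfl))
        fun s y h hy => hkK s ⟨h.1, h.2.trans_lt ht.2⟩ y hy
  have hsubIoo : Ioo 0 t ⊆ Ioo 0 T := Ioo_subset_Ioo_right ht.2.le
  have hinit : (∫ y, m (0, y)) + ∫ w, k (0, w) = 0 := by
    have h1 : ∀ y, m (0, y) = 0 := fun y => by
      simp [hmdef, he₀def, he₁def, hbdef, hs.initial_electric, hs'.initial_electric,
        hs.initial_magnetic, hs'.initial_magnetic]
    have h2 : ∀ w, k (0, w) = 0 := fun w => by
      simp [hkdef, hgdef, hs.initial_density, hs'.initial_density]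
    simp [h1, h2]
  have hzero := eq_zero_of_deriv_le_mul hcont
    (fun s h => (hasDerivAt_integral_of_zero_off (hm.mono hIoo) hKx
      (fun s h => hmK s (hIco h)) (hsubIoo h)).add (hasDerivAt_integral_of_zero_off
      (hk.mono hIoo) hKw (fun s h => hkK s (hIco h)) (hsubIoo h)))
    (fun s h => henergy s (hsubIoo h)) hinit
    (fun s _ => add_nonneg (integral_nonneg fun y => hm0 _) (integral_nonneg fun w => hk0 _))
    t ⟨ht.1, le_rfl⟩
  have hmi : 0 ≤ ∫ y, m (t, y) := integral_nonneg fun y => hm0 _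
  have hki : 0 ≤ ∫ w, k (t, w) := integral_nonneg fun y => hk0 _
  have htT : t ∈ Icc 0 T := ⟨ht.1, ht.2.le⟩
  have hmz := eq_zero_of_integral_eq_zero (hslice hm t htT) hKx (hmK t ht) (fun _ => hm0 _)
    (show ∫ y, m (t, y) = 0 by linarith) x
  have hkz := fun p => eq_zero_of_integral_eq_zero (hslice hk t htT) hKw (hkK t ht)
    (fun _ => hk0 _) (show ∫ w, k (t, w) = 0 by linarith) (x, p)
  -- The integrands vanish everywhere, by continuity; dividing by the positive weight gives the
  -- claim at `x`.
  have hWx : W (t, x) ≠ 0 := (hWpos t x (by rw [ha]; linarith)).ne'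
  have hq : e₀ (t, x) ^ 2 + e₁ (t, x) ^ 2 + b (t, x) ^ 2 = 0 := (mul_eq_zero.1 hmz).resolve_left hWx
  refine ⟨fun p => ?_, ?_, ?_⟩
  · have := (mul_eq_zero.1 (hkz p)).resolve_left hWx
    exact sub_eq_zero.1 (pow_eq_zero_iff two_ne_zero |>.1 this)
  · have h0 : e₀ (t, x) = 0 := by nlinarith [sq_nonneg (e₁ (t, x)), sq_nonneg (b (t, x))]
    have h1 : e₁ (t, x) = 0 := by nlinarith [sq_nonneg (e₀ (t, x)), sq_nonneg (b (t, x))]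
    ext i
    fin_cases i
    · exact sub_eq_zero.1 h0
    · exact sub_eq_zero.1 h1
  · have h0 : b (t, x) = 0 := by nlinarith [sq_nonneg (e₁ (t, x)), sq_nonneg (e₀ (t, x))]
    exact sub_eq_zero.1 h0

end VlasovMaxwell

theorem mainTheorem3 (T L : ℝ) (hT : 0 < T) (hL : 0 < L)
    (U : ℝ → Cb 4 VlasovMaxwell.Plane VlasovMaxwell.Plane)
    (hU : U ∈ VlasovMaxwell.controlSpace T L)
    (f₀ : VlasovMaxwell.Plane → VlasovMaxwell.Plane → ℝ)
    (hf₀ : ContDiff ℝ 2 (fun z : VlasovMaxwell.Plane × VlasovMaxwell.Plane => f₀ z.1 z.2))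
    (hf₀_supp : HasCompactSupport
      (fun z : VlasovMaxwell.Plane × VlasovMaxwell.Plane => f₀ z.1 z.2))
    (hf₀_nonneg : ∀ x p, 0 ≤ f₀ x p)
    (E₀ : Cb 3 VlasovMaxwell.Plane VlasovMaxwell.Plane) (B₀ : Cb 3 VlasovMaxwell.Plane ℝ)
    (hCC : ∀ x, VlasovMaxwell.divergence E₀ x = VlasovMaxwell.chargeDensity f₀ x)
    (f f' : ℝ → VlasovMaxwell.Plane → VlasovMaxwell.Plane → ℝ)
    (E E' : ℝ → VlasovMaxwell.Plane → VlasovMaxwell.Plane)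
    (B B' : ℝ → VlasovMaxwell.Plane → ℝ)
    (hreg : VlasovMaxwell.IsRegular T f E B) (hreg' : VlasovMaxwell.IsRegular T f' E' B')
    (hsol : VlasovMaxwell.IsSolution T (fun t => U t) f₀ E₀ B₀ f E B)
    (hsol' : VlasovMaxwell.IsSolution T (fun t => U t) f₀ E₀ B₀ f' E' B') :
    ∀ t ∈ Set.Icc 0 T, ∀ x : VlasovMaxwell.Plane,
      (∀ p : VlasovMaxwell.Plane, f t x p = f' t x p) ∧ E t x = E' t x ∧ B t x = B' t x := by
  intro t ht x
  have hlt := fun s (hs : s ∈ Ico 0 T) (y : VlasovMaxwell.Plane) =>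
    hsol.eq_of_mem_Ico hT hf₀_supp hreg hreg' hsol' hs y
  -- The energy argument differentiates at interior times and so stops short of `T`; continuity in
  -- time carries equality over to the final time.
  have hext : ∀ {X Z : Type} [NormedAddCommGroup X] [NormedAddCommGroup Z] {h h' : ℝ × X → Z},
      ContinuousOn h (Icc 0 T ×ˢ univ) → ContinuousOn h' (Icc 0 T ×ˢ univ) →
      ∀ y, (∀ s ∈ Ico 0 T, h (s, y) = h' (s, y)) → h (t, y) = h' (t, y) := by
    intro X Z _ _ h h' hc hc' y heq
    have hslice : ∀ {h : ℝ × X → Z}, ContinuousOn h (Icc 0 T ×ˢ univ) →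
        ContinuousOn (fun s => h (s, y)) (Icc 0 T) := fun hc =>
      hc.comp (by fun_prop) fun s hs => ⟨hs, mem_univ y⟩
    have hcl : Icc 0 T ⊆ closure (Ico 0 T) := by rw [closure_Ico hT.ne]
    exact Set.EqOn.of_subset_closure (s := Ico 0 T) (t := Icc 0 T) (fun s hs => heq s hs)
      (hslice hc) (hslice hc') Ico_subset_Icc_self hcl ht
  refine ⟨fun p => ?_, ?_, ?_⟩
  · exact hext hreg.density.continuousOn hreg'.density.continuousOn (x, p)
      fun s hs => (hlt s hs x).1 p
  · exact hext hreg.electric.continuousOn hreg'.electric.continuousOn x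
      fun s hs => (hlt s hs x).2.1
  · exact hext hreg.magnetic.continuousOn hreg'.magnetic.continuousOn x
      fun s hs => (hlt s hs x).2.2
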